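/- Let $n\ge 0$ and let $e_1,\dots,e_N$, $N=\binom n2$, be a uniformly random permutation of all possible edges on the vertex set $\{1,\dots,n\}$. Let $G_t$ be the graph with edges $e_1,\dots,e_t$, augmented by a pseudo root $s$ that is adjacent to all $n$ vertices, and let $T_t$ be the DFS tree of $G_t$ rooted at $s$ that is produced by a depth-first traversal. The traversal chooses the next vertex among the unvisited neighbours of the current vertex by an arbitrary rule, which may use only what the traversal has seen so far (its own history and the already inserted edges incident to visited vertices, together with their insertion times; for instance, adjacency lists sorted by vertex label or by insertion time). The stick of $T_t$ is the longest downward path from $s$ all of whose vertices have exactly one child in $T_t$; the bristles of $T_t$ are all vertices of $T_t$ that are not on the stick. Then the expected number of indices $t\in\{0,\dots,N-1\}$ such that both endpoints of the inserted edge $e_{t+1}$ lie in the bristles of $T_t$ is $O(n\log n)$: there is an absolute constant $C$ such that, for every $n$ and every such rule, this expectation is at most $C\,n\log n$. -/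

import Mathlib

/-! Depth-first search on a graph on `Fin n` that grows by edge insertions, augmented with a
pseudo root `none : Option (Fin n)` joined to every vertex. -/

/-- Adjacency in the augmented graph: the pseudo root `none` is adjacent to every vertex, and two
vertices `some a`, `some b` are adjacent when `s(a, b)` is one of the inserted edges `L`. -/
def augAdj {n : ℕ} (L : List (Sym2 (Fin n))) : Option (Fin n) → Option (Fin n) → Bool
  | none, none => false
  | none, some _ => true
  | some _, none => true
  | some a, some b => decide (a ≠ b ∧ s(a, b) ∈ L)

/-- The state of a depth-first traversal: the stack (the tree path from the current vertex, its
head, up to the root), the visited vertices (latest first), and the tree built so far, as a parent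
map (`none` for the root and for the vertices not yet visited). -/
structure DFSState (V : Type) where
  stack : List V
  visited : List V
  parent : V → Option V

namespace DFSState

/-- The initial state of a traversal from the root `r`. -/
def init {V : Type} (r : V) : DFSState V where
  stack := [r]
  visited := [r]
  parent := fun _ => none

end DFSState

/-- What a traversal with visited vertices `W` has seen of the insertion sequence `L`: the
inserted edges with an endpoint in `W`, with their times of insertion. All other entries are
hidden (`none`). -/
def exploredPart {n : ℕ} (L : List (Sym2 (Fin n))) (W : List (Option (Fin n))) :
    List (Option (Sym2 (Fin n))) :=
  L.map fun e => if ∃ a ∈ e, some a ∈ W then some e else none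

/-- The unvisited neighbours of `v`. -/
def unvisitedNeighbors {n : ℕ} (L : List (Sym2 (Fin n))) (W : List (Option (Fin n)))
    (v : Option (Fin n)) : Finset (Option (Fin n)) :=
  Finset.univ.filter fun w => augAdj L v w = true ∧ w ∉ W

/-- A rule by which a depth-first traversal picks the next vertex among the (nonempty) set of
unvisited neighbours of the current vertex. It may use everything that the traversal has seen so
far: the explored part of the insertion sequence and the state. Adjacency lists sorted by vertex
label, by time of insertion, or in any order fixed beforehand are examples. -/
structure DFSRule (n : ℕ) where
  next : List (Option (Sym2 (Fin n))) → DFSState (Option (Fin n)) →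
    Finset (Option (Fin n)) → Option (Fin n)
  next_mem : ∀ seen S C, C.Nonempty → next seen S C ∈ C

/-- One step of the traversal: if the current vertex has an unvisited neighbour, visit the one
picked by the rule as a child of the current vertex; otherwise backtrack. -/
def dfsStep {n : ℕ} (R : DFSRule n) (L : List (Sym2 (Fin n)))
    (S : DFSState (Option (Fin n))) : DFSState (Option (Fin n)) :=
  match S.stack with
  | [] => S
  | v :: rest =>
    if (unvisitedNeighbors L S.visited v).Nonempty then
      let w := R.next (exploredPart L S.visited) S (unvisitedNeighbors L S.visited v)
      { stack := w :: v :: rest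
        visited := w :: S.visited
        parent := Function.update S.parent w (some v) }
    else
      { stack := rest, visited := S.visited, parent := S.parent }

/-- The DFS tree (as a parent map), rooted at the pseudo root `none`, of the augmented graph with
inserted edges `L`. The traversal makes `n` visits and `n + 1` backtracking steps; then the stack
is empty. -/
def dfsTree {n : ℕ} (R : DFSRule n) (L : List (Sym2 (Fin n))) :
    Option (Fin n) → Option (Option (Fin n)) :=
  ((dfsStep R L)^[2 * n + 1] (DFSState.init none)).parent

/-- The stick of a rooted tree given by its parent map: the longest downward path from the root
`r` all of whose vertices have exactly one child. -/
inductive OnStick {V : Type} (parent : V → Option V) (r : V) : V → Prop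
  | root : (∃! w, parent w = some r) → OnStick parent r r
  | child {v w : V} : OnStick parent r v → parent w = some v → (∃! u, parent u = some w) →
      OnStick parent r w

/-- The bristles: all vertices that are not on the stick. -/
def bristles {V : Type} (parent : V → Option V) (r : V) : Set V :=
  {v | ¬ OnStick parent r v}

/-- A sequence of insertions of all possible edges on `n` vertices, each inserted once. -/
abbrev InsertionSeq (n : ℕ) : Type :=
  Fin (n.choose 2) ≃ {e : Sym2 (Fin n) // ¬ e.IsDiag}

/-- The edges inserted before time `t`, in order of insertion. -/
def insertedBefore {n : ℕ} (σ : InsertionSeq n) (t : ℕ) : List (Sym2 (Fin n)) :=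
  (List.ofFn fun i => (σ i : Sym2 (Fin n))).take t

/-- The number of insertions whose edge has both endpoints in the bristles of the DFS tree of the
graph just before the insertion. -/
noncomputable def bristleInsertions {n : ℕ} (R : DFSRule n) (σ : InsertionSeq n) : ℕ :=
  Set.ncard {t : Fin (n.choose 2) |
    ∀ a ∈ (σ t : Sym2 (Fin n)), some a ∈ bristles (dfsTree R (insertedBefore σ t)) none}

/-- There are insertion sequences. -/
theorem insertionSeq_nonempty (n : ℕ) : Nonempty (InsertionSeq n) := by
  refine Fintype.card_eq.mp ?_
  rw [Fintype.card_fin, Sym2.card_subtype_not_diag, Fintype.card_fin]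

/-- The expectation of `X` for a uniformly random insertion sequence. -/
noncomputable def expectedOverInsertions (n : ℕ) (X : InsertionSeq n → ℝ) : ℝ :=
  (∑ σ : InsertionSeq n, X σ) / (Fintype.card (InsertionSeq n) : ℝ)

/-! Fix a time `t`, put `N = n.choose 2`, and reveal the edges only as the traversal meets them.
After `i` steps it has seen nothing of the edges inside the unvisited set `U`, so exchanging two
such edges in the insertion sequence does not affect these steps (`exploredPart_swap`,
`dfsRun_congr`). Hence, given `U` and a lower bound `κ` on the fraction of edges inside `U` already
inserted, a cut of `U` with `m` possible edges is empty with probability at most `(1 - κ) ^ m`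
(`card_avoid_le`). A union bound over cuts makes `U` connected with high probability, provided `κ *
#U` is a large multiple of `log n`. The density hypothesis, with `κ = t / (8 * N)`, holds for all
`U` with at least `r` vertices simultaneously by a lower tail bound (`card_lower_tail_le`).
Together, if `r * κ ≥ 16 * log n`, every unvisited set met in steps `0, …, n - r` is connected,
except with probability `4 / n ^ 2`.

Connectivity forces the shape of the tree. While the unvisited part is connected, the traversal
moves straight down; afterwards it cannot return to the path before everything is visited. So the
path lies on the stick (`onStick_of_cutConnected`), and the bristles lie in a set of at most `r`
vertices determined by the first `t` edges. The next edge is uniform among the `N - t` remaining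
ones and falls into that set with probability at most `r ^ 2 / (2 * (N - t))`.

With `r ≈ 128 * N * log n / t` these bounds sum to `O(n log n)` over the middle range of `t`. The
first and last `O(n log n)` insertions are counted trivially. -/

open Finset

/-! ### Random bijections: avoidance, lower tail and exchangeability by swapping. -/

section RandomEquiv

variable {A B : Type} [Fintype B] [DecidableEq A] [DecidableEq B]

/-- Among the equivalences in a set closed under swaps of elements of `E'`, those sending a given
`C ⊆ E'` away from `D` are few, if each member sends many elements of `E'` into `D`. -/
theorem card_avoid_le (S : Finset (A ≃ B)) (E' : Finset B) (D : Finset A) (κ : ℝ)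
    (hκ : κ ≤ 1)
    (hS : ∀ σ ∈ S, ∀ x ∈ E', ∀ y ∈ E', σ.trans (Equiv.swap x y) ∈ S)
    (hD : ∀ σ ∈ S, κ * (#E' : ℝ) ≤ #{e ∈ E' | σ.symm e ∈ D})
    (C : Finset B) (hC : C ⊆ E') :
    (#{σ ∈ S | ∀ e ∈ C, σ.symm e ∉ D} : ℝ) ≤ (1 - κ) ^ #C * #S := by
  induction C using Finset.induction_on with
  | empty => simp
  | insert x C hx ih =>
    have hCE : C ⊆ E' := fun a ha => hC (mem_insert_of_mem ha)
    have hxE : x ∈ E' := hC (mem_insert_self _ _)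
    specialize ih hCE
    rw [card_insert_of_notMem hx, pow_succ]
    set P : Finset (A ≃ B) := {σ ∈ S | ∀ e ∈ C, σ.symm e ∉ D} with hP
    have hins : ∀ y, ({σ ∈ S | ∀ e ∈ insert y C, σ.symm e ∉ D} : Finset (A ≃ B))
        = {σ ∈ P | σ.symm y ∉ D} := by
      intro y; ext σ; simp only [hP, mem_filter, mem_insert, forall_eq_or_imp]; tauto
    rw [hins]
    -- Exchanging `x` and `y` preserves `P`, so all elements of `E' \ C` avoid `D` equally often;
    -- the count for `x` is thus an average over `E' \ C`.
    have hswap : ∀ y ∈ E' \ C, #{σ ∈ P | σ.symm y ∉ D} = #{σ ∈ P | σ.symm x ∉ D} := by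
      intro y hy
      rw [mem_sdiff] at hy
      have key : ∀ u v, u ∈ E' → v ∈ E' → u ∉ C → v ∉ C → ∀ σ ∈ ({σ ∈ P | σ.symm u ∉ D} :
          Finset (A ≃ B)), σ.trans (Equiv.swap u v) ∈ ({σ ∈ P | σ.symm v ∉ D} :
          Finset (A ≃ B)) := by
        intro u v hu hv huC hvC σ hσ
        simp only [hP, mem_filter] at hσ ⊢
        refine ⟨⟨hS σ hσ.1.1 u hu v hv, fun e he => ?_⟩, ?_⟩
        · rw [Equiv.symm_trans_apply, Equiv.symm_swap, Equiv.swap_apply_of_ne_of_ne]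
          · exact hσ.1.2 e he
          · rintro rfl; exact huC he
          · rintro rfl; exact hvC he
        · simpa [Equiv.symm_trans_apply] using hσ.2
      refine Finset.card_bij' (fun σ _ => σ.trans (Equiv.swap y x))
        (fun σ _ => σ.trans (Equiv.swap x y)) (key y x hy.1 hxE hy.2 hx)
        (key x y hxE hy.1 hx hy.2) ?_ ?_
      · intro σ _; ext a; simp [Equiv.swap_comm y x]
      · intro σ _; ext a; simp [Equiv.swap_comm y x]
    have hdc : ∑ y ∈ E' \ C, #{σ ∈ P | σ.symm y ∉ D}
        = ∑ σ ∈ P, #{y ∈ E' \ C | σ.symm y ∉ D} := by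
      simp only [card_filter]
      exact sum_comm
    rw [sum_congr rfl hswap, sum_const, smul_eq_mul] at hdc
    have hsd : (#(E' \ C) : ℝ) = #E' - #C := by
      rw [card_sdiff_of_subset hCE, Nat.cast_sub (card_le_card hCE)]
    -- In `P` no element of `C` goes to `D`, so all of the at least `κ * #E'` hits lie in `E' \ C`.
    have hone : ∀ σ ∈ P, (#{y ∈ E' \ C | σ.symm y ∉ D} : ℝ) ≤ (1 - κ) * #E' - #C := by
      intro σ hσ
      simp only [hP, mem_filter] at hσ
      have h1 := hD σ hσ.1
      have h2 := card_filter_add_card_filter_not (s := E' \ C) (fun y => σ.symm y ∈ D)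
      have h3 : #{e ∈ E' | σ.symm e ∈ D} = #{e ∈ E' \ C | σ.symm e ∈ D} := by
        congr 1; ext e; simp only [mem_filter, mem_sdiff]
        constructor
        · rintro ⟨a, b⟩; exact ⟨⟨a, fun hc => hσ.2 e hc b⟩, b⟩
        · rintro ⟨⟨a, _⟩, b⟩; exact ⟨a, b⟩
      rw [h3] at h1
      have h4 : (#{e ∈ E' \ C | σ.symm e ∈ D} : ℝ) + #{e ∈ E' \ C | σ.symm e ∉ D}
          = #E' - #C := by rw [← hsd]; exact_mod_cast h2
      linarith
    have hsum : (#(E' \ C) : ℝ) * #{σ ∈ P | σ.symm x ∉ D} ≤ #P * ((1 - κ) * #E' - #C) := by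
      have : (#(E' \ C) : ℝ) * #{σ ∈ P | σ.symm x ∉ D}
          = ∑ σ ∈ P, (#{y ∈ E' \ C | σ.symm y ∉ D} : ℝ) := by exact_mod_cast hdc
      rw [this, ← nsmul_eq_mul]
      exact sum_le_card_nsmul _ _ _ hone
    have hpos : (0 : ℝ) < #(E' \ C) := by
      exact_mod_cast card_pos.mpr ⟨x, mem_sdiff.mpr ⟨hxE, hx⟩⟩
    have hle : (#{σ ∈ P | σ.symm x ∉ D} : ℝ) ≤ #P := by
      exact_mod_cast card_filter_le _ _
    have hstep : (#{σ ∈ P | σ.symm x ∉ D} : ℝ) ≤ (1 - κ) * #P := by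
      -- For `κ ≥ 0`, `(1 - κ) * #E' - #C ≤ (1 - κ) * (#E' - #C)`: removing avoiding elements only
      -- raises the hit density. For `κ < 0` the factor exceeds one.
      rcases le_or_gt 0 κ with h0 | h0
      · have : (#(E' \ C) : ℝ) * #{σ ∈ P | σ.symm x ∉ D} ≤ #(E' \ C) * ((1 - κ) * #P) := by
          refine hsum.trans ?_
          rw [hsd]
          have : 0 ≤ κ * (#C : ℝ) * #P := by positivity
          nlinarith
        exact le_of_mul_le_mul_left this hpos
      · have : (0 : ℝ) ≤ #P := by positivity
        nlinarith
    calc (#{σ ∈ P | σ.symm x ∉ D} : ℝ) ≤ (1 - κ) * #P := hstep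
      _ ≤ (1 - κ) * ((1 - κ) ^ #C * #S) := by
          apply mul_le_mul_of_nonneg_left ih; linarith
      _ = _ := by ring

variable [Fintype A]

/-- The truncated exponential moment of the number of elements of `F` sent to `D`. -/
theorem sum_truncated_moment_le (F : Finset B) (D : Finset A) :
    ∑ σ : A ≃ B, (if 2 * #{e ∈ F | σ.symm e ∈ D} ≤ #D
        then (1 / 2 : ℝ) ^ #{e ∈ F | σ.symm e ∈ D} else 0)
      ≤ (1 - #D / (4 * Fintype.card B)) ^ #F * Fintype.card (A ≃ B) := by
  have hcardE : ∀ σ : A ≃ B, Fintype.card A = Fintype.card B := fun σ => Fintype.card_congr σ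
  rcases isEmpty_or_nonempty (A ≃ B) with hE | ⟨⟨σ₀⟩⟩
  · simp
  have hDB : (#D : ℝ) ≤ Fintype.card B := by
    rw [← hcardE σ₀]; exact_mod_cast card_le_univ D
  have hq : (#D : ℝ) / (4 * Fintype.card B) ≤ 1 := by
    apply div_le_one_of_le₀ _ (by positivity)
    have : (0 : ℝ) ≤ Fintype.card B := by positivity
    linarith
  induction F using Finset.induction_on with
  | empty => simp
  | insert x F hx ih =>
    set w : (A ≃ B) → ℝ := fun σ => if 2 * #{e ∈ F | σ.symm e ∈ D} ≤ #D
        then (1 / 2 : ℝ) ^ #{e ∈ F | σ.symm e ∈ D} else 0 with hw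
    have hw0 : ∀ σ, 0 ≤ w σ := by intro σ; simp only [hw]; split_ifs <;> positivity
    -- A hit by the new element `x` halves the weight or truncates it to zero; a miss leaves it
    -- unchanged.
    have hstep : ∀ σ : A ≃ B, (if 2 * #{e ∈ insert x F | σ.symm e ∈ D} ≤ #D
        then (1 / 2 : ℝ) ^ #{e ∈ insert x F | σ.symm e ∈ D} else 0)
        ≤ w σ - 1 / 2 * (w σ * if σ.symm x ∈ D then 1 else 0) := by
      intro σ
      by_cases hxD : σ.symm x ∈ D
      · rw [filter_insert, if_pos hxD, card_insert_of_notMem (by simp [hx])]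
        simp only [hw, if_pos hxD, pow_succ]
        split_ifs with h1 h2 h2
        · linarith
        · omega
        · have : (0 : ℝ) ≤ (1 / 2) ^ #{e ∈ F | σ.symm e ∈ D} := by positivity
          linarith
        · simp
      · rw [filter_insert, if_neg hxD]
        simp [hw, hxD]
    have hswap : ∀ y ∈ univ \ F, ∑ σ, (w σ * if σ.symm y ∈ D then (1 : ℝ) else 0)
        = ∑ σ, w σ * if σ.symm x ∈ D then (1 : ℝ) else 0 := by
      intro y hy
      have hyF : y ∉ F := by simpa using hy
      refine Fintype.sum_equiv ((Equiv.refl A).equivCongr (Equiv.swap x y)) _ _ fun σ => ?_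
      have h1 : ({e ∈ F | ((Equiv.refl A).equivCongr (Equiv.swap x y) σ).symm e ∈ D} : Finset B)
          = {e ∈ F | σ.symm e ∈ D} := by
        refine filter_congr fun e he => ?_
        have : Equiv.swap x y e = e := Equiv.swap_apply_of_ne_of_ne
          (by rintro rfl; exact hx he) (by rintro rfl; exact hyF he)
        simp [Equiv.equivCongr, this]
      simp only [hw, h1]
      simp [Equiv.equivCongr]
    have hdc : ∑ y ∈ univ \ F, ∑ σ, (w σ * if σ.symm y ∈ D then (1 : ℝ) else 0)
        = ∑ σ, w σ * #{y ∈ univ \ F | σ.symm y ∈ D} := by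
      rw [sum_comm]
      refine sum_congr rfl fun σ _ => ?_
      rw [← mul_sum, card_filter]; push_cast; rfl
    rw [sum_congr rfl hswap, sum_const, nsmul_eq_mul] at hdc
    -- The purpose of the truncation: where the weight is nonzero, at least half of `D` is still hit
    -- from outside `F`.
    have hcount : ∀ σ : A ≃ B, w σ * (#D / 2) ≤ w σ * #{y ∈ univ \ F | σ.symm y ∈ D} := by
      intro σ
      by_cases h : 2 * #{e ∈ F | σ.symm e ∈ D} ≤ #D
      · apply mul_le_mul_of_nonneg_left _ (hw0 σ)
        have h1 : #{y ∈ univ | σ.symm y ∈ D} = #D := by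
          rw [← card_map σ.toEmbedding]
          congr 1; ext y; simp [Finset.mem_map_equiv]
        have h2 : #{y ∈ univ | σ.symm y ∈ D}
            = #{e ∈ F | σ.symm e ∈ D} + #{y ∈ univ \ F | σ.symm y ∈ D} := by
          rw [← card_union_of_disjoint, ← filter_union, union_sdiff_of_subset (subset_univ F)]
          exact disjoint_filter_filter disjoint_sdiff
        have h3 : (#{e ∈ F | σ.symm e ∈ D} : ℝ) + #{y ∈ univ \ F | σ.symm y ∈ D} = #D := by
          rw [← h1, h2]; push_cast; rfl
        have h4 : 2 * (#{e ∈ F | σ.symm e ∈ D} : ℝ) ≤ #D := by exact_mod_cast h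
        linarith
      · simp [hw, h]
    have hlow : (∑ σ, w σ) * (#D / (2 * Fintype.card B))
        ≤ ∑ σ, w σ * if σ.symm x ∈ D then (1 : ℝ) else 0 := by
      have h1 : (∑ σ, w σ) * (#D / 2)
          ≤ (#(univ \ F) : ℝ) * ∑ σ, w σ * if σ.symm x ∈ D then (1 : ℝ) else 0 := by
        rw [hdc, sum_mul]; exact sum_le_sum fun σ _ => hcount σ
      have h2 : (#(univ \ F) : ℝ) ≤ Fintype.card B := by exact_mod_cast card_le_univ _
      have h3 : 0 ≤ ∑ σ, w σ * if σ.symm x ∈ D then (1 : ℝ) else 0 :=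
        sum_nonneg fun σ _ => mul_nonneg (hw0 σ) (by split_ifs <;> norm_num)
      have hB : (0 : ℝ) < Fintype.card B := by
        exact_mod_cast Fintype.card_pos_iff.mpr ⟨x⟩
      rw [show (∑ σ, w σ) * ((#D : ℝ) / (2 * Fintype.card B))
        = ((∑ σ, w σ) * (#D / 2)) / Fintype.card B by field_simp, div_le_iff₀ hB]
      nlinarith
    rw [card_insert_of_notMem hx, pow_succ]
    calc _ ≤ ∑ σ, (w σ - 1 / 2 * (w σ * if σ.symm x ∈ D then 1 else 0)) :=
          sum_le_sum fun σ _ => hstep σ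
      _ = (∑ σ, w σ) - 1 / 2 * ∑ σ, w σ * if σ.symm x ∈ D then (1 : ℝ) else 0 := by
          rw [sum_sub_distrib, mul_sum]
      _ ≤ (1 - #D / (4 * Fintype.card B)) * ∑ σ, w σ := by
          have : (#D : ℝ) / (4 * Fintype.card B) = 1 / 2 * (#D / (2 * Fintype.card B)) := by
            ring
          rw [this]; linarith
      _ ≤ (1 - #D / (4 * Fintype.card B)) *
          ((1 - #D / (4 * Fintype.card B)) ^ #F * Fintype.card (A ≃ B)) :=
          mul_le_mul_of_nonneg_left ih (by linarith)
      _ = _ := by ring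

/-- Lower tail bound for the number of elements of `F` sent to `D` by a random equivalence. -/
theorem card_lower_tail_le (F : Finset B) (D : Finset A) :
    (#{σ : A ≃ B | (#{e ∈ F | σ.symm e ∈ D} : ℝ) ≤ #F * (#D / (8 * Fintype.card B))} : ℝ)
      ≤ Real.exp (-(#F * (#D / (8 * Fintype.card B)))) * Fintype.card (A ≃ B) := by
  set k : ℝ := #F * (#D / (8 * Fintype.card B)) with hk
  rcases isEmpty_or_nonempty (A ≃ B) with hE | ⟨⟨σ₀⟩⟩
  · simp
  have hk0 : 0 ≤ k := by positivity
  have hFB : (#F : ℝ) ≤ Fintype.card B := by exact_mod_cast card_le_univ F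
  have hDB : (#D : ℝ) ≤ Fintype.card B := by
    rw [← Fintype.card_congr σ₀]; exact_mod_cast card_le_univ D
  have hkD : 2 * k ≤ #D := by
    rcases Nat.eq_zero_or_pos (Fintype.card B) with h0 | h0
    · simp [hk, h0]
    · have hB : (0 : ℝ) < Fintype.card B := by exact_mod_cast h0
      have : k = #D * (#F / Fintype.card B) / 8 := by rw [hk]; field_simp
      have h1 : (#F : ℝ) / Fintype.card B ≤ 1 := div_le_one_of_le₀ hFB hB.le
      have h2 : (0 : ℝ) ≤ #D := by positivity
      have h3 : (0 : ℝ) ≤ #F / Fintype.card B := by positivity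
      nlinarith
  have hmom := sum_truncated_moment_le F D (A := A)
  -- Markov's inequality: on the tail event the truncation is inactive since `2 * k ≤ #D`, and the
  -- weight is at least `exp (-k)` because `1 / 2 ≥ exp (-1)`. The moment is at most `exp (-(2 *
  -- k))`, which leaves `exp (-k)`.
  have hpt : ∀ σ ∈ ({σ : A ≃ B | (#{e ∈ F | σ.symm e ∈ D} : ℝ) ≤ k} : Finset (A ≃ B)),
      Real.exp (-k) ≤ if 2 * #{e ∈ F | σ.symm e ∈ D} ≤ #D
        then (1 / 2 : ℝ) ^ #{e ∈ F | σ.symm e ∈ D} else 0 := by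
    intro σ hσ
    have hσ : (#{e ∈ F | σ.symm e ∈ D} : ℝ) ≤ k := by simpa using hσ
    have h2 : 2 * #{e ∈ F | σ.symm e ∈ D} ≤ #D := by
      have : 2 * (#{e ∈ F | σ.symm e ∈ D} : ℝ) ≤ #D := by linarith
      exact_mod_cast this
    rw [if_pos h2]
    calc Real.exp (-k) ≤ Real.exp (-(#{e ∈ F | σ.symm e ∈ D} : ℝ)) :=
          Real.exp_le_exp.mpr (by linarith)
      _ = Real.exp (-1) ^ #{e ∈ F | σ.symm e ∈ D} := by
          rw [← Real.exp_nat_mul]; congr 1; ring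
      _ ≤ _ := by
          apply pow_le_pow_left₀ (Real.exp_pos _).le
          rw [Real.exp_neg, one_div]
          apply inv_anti₀ (by norm_num)
          have := Real.add_one_le_exp (1 : ℝ)
          linarith
  have hsum : (#{σ : A ≃ B | (#{e ∈ F | σ.symm e ∈ D} : ℝ) ≤ k} : ℝ) * Real.exp (-k)
      ≤ (1 - #D / (4 * Fintype.card B)) ^ #F * Fintype.card (A ≃ B) := by
    refine le_trans ?_ hmom
    rw [← nsmul_eq_mul]
    refine (card_nsmul_le_sum _ _ _ hpt).trans ?_
    refine sum_le_sum_of_subset_of_nonneg (subset_univ _) fun σ _ _ => ?_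
    split_ifs <;> positivity
  have hpow : (1 - (#D : ℝ) / (4 * Fintype.card B)) ^ #F ≤ Real.exp (-(2 * k)) := by
    have h1 : (1 - (#D : ℝ) / (4 * Fintype.card B)) ≤ Real.exp (-(#D / (4 * Fintype.card B))) := by
      have := Real.add_one_le_exp (-((#D : ℝ) / (4 * Fintype.card B)))
      linarith
    have h0 : 0 ≤ (1 - (#D : ℝ) / (4 * Fintype.card B)) := by
      have : (#D : ℝ) / (4 * Fintype.card B) ≤ 1 := by
        apply div_le_one_of_le₀ _ (by positivity)
        have : (0 : ℝ) ≤ Fintype.card B := by positivity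
        linarith
      linarith
    refine (pow_le_pow_left₀ h0 h1 _).trans (le_of_eq ?_)
    rw [← Real.exp_nat_mul]; congr 1; rw [hk]; ring
  have hkk : Real.exp (-(2 * k)) = Real.exp (-k) * Real.exp (-k) := by
    rw [← Real.exp_add]; congr 1; ring
  have hc : (0 : ℝ) ≤ Fintype.card (A ≃ B) := by positivity
  refine le_of_mul_le_mul_right (hsum.trans ?_) (Real.exp_pos (-k))
  calc _ ≤ Real.exp (-(2 * k)) * Fintype.card (A ≃ B) := mul_le_mul_of_nonneg_right hpow hc
    _ = _ := by rw [hkk]; ring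

/-- If a set `S σ` of at most `s` elements is not changed by swapping arguments of `σ` in `Q`,
then for `t ∈ Q` it is rare that `σ t ∈ S σ`. -/
theorem card_apply_mem_mul_le (Q : Finset A) (S : (A ≃ B) → Finset B) (s : ℝ)
    (hs : ∀ σ, (#(S σ) : ℝ) ≤ s)
    (hS : ∀ σ, ∀ x ∈ Q, ∀ y ∈ Q, S ((Equiv.swap x y).trans σ) = S σ) (t : A) (ht : t ∈ Q) :
    (#{σ : A ≃ B | σ t ∈ S σ} : ℝ) * #Q ≤ s * Fintype.card (A ≃ B) := by
  have hswap : ∀ j ∈ Q, #{σ : A ≃ B | σ j ∈ S σ} = #{σ : A ≃ B | σ t ∈ S σ} := by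
    intro j hj
    refine Finset.card_bij' (fun σ _ => (Equiv.swap j t).trans σ)
      (fun σ _ => (Equiv.swap j t).trans σ) ?_ ?_ ?_ ?_
    · intro σ hσ
      simp only [mem_filter, mem_univ, true_and] at hσ ⊢
      rw [hS σ j hj t ht]; simpa using hσ
    · intro σ hσ
      simp only [mem_filter, mem_univ, true_and] at hσ ⊢
      rw [hS σ j hj t ht]; simpa using hσ
    · intro σ _; ext a; simp
    · intro σ _; ext a; simp
  have hdc : ∑ j ∈ Q, #{σ : A ≃ B | σ j ∈ S σ} = ∑ σ : A ≃ B, #{j ∈ Q | σ j ∈ S σ} := by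
    simp only [card_filter]
    exact sum_comm
  rw [sum_congr rfl hswap, sum_const, smul_eq_mul] at hdc
  have hle : ∀ σ ∈ (univ : Finset (A ≃ B)), (#{j ∈ Q | σ j ∈ S σ} : ℝ) ≤ s := by
    intro σ _
    refine le_trans ?_ (hs σ)
    exact_mod_cast card_le_card_of_injOn σ (fun j hj => by simp at hj; exact hj.2)
      σ.injective.injOn
  have : (#Q : ℝ) * #{σ : A ≃ B | σ t ∈ S σ} = ∑ σ : A ≃ B, (#{j ∈ Q | σ j ∈ S σ} : ℝ) := by
    exact_mod_cast hdc
  rw [mul_comm, this]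
  refine (sum_le_card_nsmul _ _ _ hle).trans (le_of_eq ?_)
  rw [nsmul_eq_mul, mul_comm, card_univ]

end RandomEquiv

/-! ### Depth-first search: locality, the initial path and the stick. -/

section Traversal

variable {n : ℕ}

theorem mem_exploredPart {L : List (Sym2 (Fin n))} {W : List (Option (Fin n))} {e : Sym2 (Fin n)}
    (he : ∃ a ∈ e, some a ∈ W) : some e ∈ exploredPart L W ↔ e ∈ L := by
  simp only [exploredPart, List.mem_map]
  constructor
  · rintro ⟨e', he', h⟩
    split_ifs at h
    rwa [← Option.some.inj h]
  · intro h; exact ⟨e, h, if_pos he⟩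

/-- What is seen from fewer vertices is a function of what is seen from more. Agreement of two
sequences at the end of a run therefore passes to all its earlier stages. -/
theorem exploredPart_of_subset (L : List (Sym2 (Fin n))) {W W' : List (Option (Fin n))}
    (h : W' ⊆ W) : exploredPart L W' = (exploredPart L W).map
      (fun o => o.bind fun e => if ∃ a ∈ e, some a ∈ W' then some e else none) := by
  simp only [exploredPart, List.map_map]
  refine List.map_congr_left fun e _ => ?_
  by_cases h1 : ∃ a ∈ e, some a ∈ W'
  · obtain ⟨a, ha, haW⟩ := h1
    have h1 : ∃ a ∈ e, some a ∈ W' := ⟨a, ha, haW⟩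
    have h2 : ∃ a ∈ e, some a ∈ W := ⟨a, ha, h haW⟩
    simp [if_pos h1, if_pos h2]
  · by_cases h2 : ∃ a ∈ e, some a ∈ W
    · simp [if_neg h1, if_pos h2]
    · simp [if_neg h1, if_neg h2]

theorem unvisitedNeighbors_congr {L L' : List (Sym2 (Fin n))} {W : List (Option (Fin n))}
    (h : exploredPart L W = exploredPart L' W) {v : Option (Fin n)} (hv : v ∈ W) :
    unvisitedNeighbors L W v = unvisitedNeighbors L' W v := by
  unfold unvisitedNeighbors
  refine filter_congr fun w _ => ?_
  rcases v with _ | a <;> rcases w with _ | b <;> simp only [augAdj]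
  have : s(a, b) ∈ L ↔ s(a, b) ∈ L' := by
    rw [← mem_exploredPart (L := L) (W := W) ⟨a, by simp, hv⟩,
      ← mem_exploredPart (L := L') (W := W) ⟨a, by simp, hv⟩, h]
  simp [this]

/-- The state of the traversal after `i` steps. -/
def dfsRun (R : DFSRule n) (L : List (Sym2 (Fin n))) (i : ℕ) : DFSState (Option (Fin n)) :=
  (dfsStep R L)^[i] (DFSState.init none)

theorem dfsRun_succ (R : DFSRule n) (L : List (Sym2 (Fin n))) (i : ℕ) :
    dfsRun R L (i + 1) = dfsStep R L (dfsRun R L i) :=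
  Function.iterate_succ_apply' _ _ _

theorem dfsStep_of_nonempty (R : DFSRule n) (L : List (Sym2 (Fin n)))
    {S : DFSState (Option (Fin n))} {v : Option (Fin n)} {rest : List (Option (Fin n))}
    (hS : S.stack = v :: rest) (h : (unvisitedNeighbors L S.visited v).Nonempty) :
    ∃ w ∈ unvisitedNeighbors L S.visited v, dfsStep R L S =
      { stack := w :: v :: rest
        visited := w :: S.visited
        parent := Function.update S.parent w (some v) } := by
  refine ⟨_, R.next_mem (exploredPart L S.visited) S _ h, ?_⟩
  unfold dfsStep
  rw [hS]
  simp only [if_pos h]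

theorem dfsStep_of_empty (R : DFSRule n) (L : List (Sym2 (Fin n)))
    {S : DFSState (Option (Fin n))} {v : Option (Fin n)} {rest : List (Option (Fin n))}
    (hS : S.stack = v :: rest) (h : ¬ (unvisitedNeighbors L S.visited v).Nonempty) :
    dfsStep R L S = { stack := rest, visited := S.visited, parent := S.parent } := by
  unfold dfsStep
  rw [hS]
  simp only [if_neg h]

theorem dfsStep_of_nil (R : DFSRule n) (L : List (Sym2 (Fin n)))
    {S : DFSState (Option (Fin n))} (hS : S.stack = []) : dfsStep R L S = S := by
  unfold dfsStep
  rw [hS]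

theorem stack_subset_visited_step (R : DFSRule n) (L : List (Sym2 (Fin n)))
    {S : DFSState (Option (Fin n))} (h : S.stack ⊆ S.visited) :
    (dfsStep R L S).stack ⊆ (dfsStep R L S).visited ∧ S.visited ⊆ (dfsStep R L S).visited := by
  rcases hS : S.stack with _ | ⟨v, rest⟩
  · rw [dfsStep_of_nil R L hS]; exact ⟨h, fun _ => id⟩
  · by_cases hne : (unvisitedNeighbors L S.visited v).Nonempty
    · obtain ⟨w, -, hw⟩ := dfsStep_of_nonempty R L hS hne
      rw [hw]
      rw [hS] at h
      exact ⟨List.cons_subset_cons _ h, List.subset_cons_self _ _⟩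
    · rw [dfsStep_of_empty R L hS hne]
      rw [hS] at h
      exact ⟨fun x hx => h (List.mem_cons_of_mem _ hx), fun _ => id⟩

theorem stack_subset_visited (R : DFSRule n) (L : List (Sym2 (Fin n))) (i : ℕ) :
    (dfsRun R L i).stack ⊆ (dfsRun R L i).visited := by
  induction i with
  | zero => simp [dfsRun, DFSState.init]
  | succ i ih => rw [dfsRun_succ]; exact (stack_subset_visited_step R L ih).1

theorem visited_subset_succ (R : DFSRule n) (L : List (Sym2 (Fin n))) (i : ℕ) :
    (dfsRun R L i).visited ⊆ (dfsRun R L (i + 1)).visited := by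
  rw [dfsRun_succ]; exact (stack_subset_visited_step R L (stack_subset_visited R L i)).2

theorem dfsStep_congr (R : DFSRule n) {L L' : List (Sym2 (Fin n))}
    {S : DFSState (Option (Fin n))} (hS : S.stack ⊆ S.visited)
    (h : exploredPart L S.visited = exploredPart L' S.visited) :
    dfsStep R L S = dfsStep R L' S := by
  unfold dfsStep
  rcases hst : S.stack with _ | ⟨v, rest⟩
  · rfl
  · have hv : v ∈ S.visited := hS (by simp [hst])
    simp only [unvisitedNeighbors_congr h hv, h]

/-- The traversal only depends on what it explores. -/
theorem dfsRun_congr (R : DFSRule n) {L L' : List (Sym2 (Fin n))} (i : ℕ)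
    (h : exploredPart L (dfsRun R L i).visited = exploredPart L' (dfsRun R L i).visited) :
    dfsRun R L' i = dfsRun R L i := by
  induction i with
  | zero => rfl
  | succ i ih =>
    have h' : exploredPart L (dfsRun R L i).visited = exploredPart L' (dfsRun R L i).visited := by
      rw [exploredPart_of_subset L (visited_subset_succ R L i),
        exploredPart_of_subset L' (visited_subset_succ R L i), h]
    rw [dfsRun_succ, dfsRun_succ, ih h', dfsStep_congr R (stack_subset_visited R L i) h']

/-- The vertices not yet visited. -/
def unvisitedSet (S : DFSState (Option (Fin n))) : Finset (Fin n) :=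
  univ.filter fun v => some v ∉ S.visited

@[simp]
theorem mem_unvisitedSet {S : DFSState (Option (Fin n))} {v : Fin n} :
    v ∈ unvisitedSet S ↔ some v ∉ S.visited := by
  simp [unvisitedSet]

/-- The edges in `L` connect the vertices of `U` among themselves. -/
def CutConnected (L : List (Sym2 (Fin n))) (U : Finset (Fin n)) : Prop :=
  ∀ A ⊆ U, A.Nonempty → A ≠ U → ∃ a ∈ A, ∃ b ∈ U \ A, s(a, b) ∈ L

theorem some_mem_unvisitedNeighbors {L : List (Sym2 (Fin n))} {W : List (Option (Fin n))}
    {a b : Fin n} (hab : s(a, b) ∈ L) (hne : a ≠ b) (hb : some b ∉ W) :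
    some b ∈ unvisitedNeighbors L W (some a) := by
  simp [unvisitedNeighbors, augAdj, hab, hne, hb]

/-- A chain of parents down from the root, of vertices with one child each, lies on the stick. -/
theorem onStick_of_isChain {V : Type} {parent : V → Option V} {r : V} (l : List V)
    (h1 : ∀ v ∈ l, ∃! w, parent w = some v)
    (h2 : l.IsChain fun a b => parent a = some b) (h3 : l.getLast? = some r) :
    ∀ v ∈ l, OnStick parent r v := by
  induction l with
  | nil => simp
  | cons a l ih =>
    rcases l with _ | ⟨b, l⟩
    · intro v hv
      obtain rfl : v = a := by simpa using hv
      obtain rfl : v = r := by simpa using h3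
      exact OnStick.root (h1 _ hv)
    · have ih' := ih (fun v hv => h1 v (List.mem_cons_of_mem _ hv)) h2.of_cons (by simpa using h3)
      intro v hv
      rcases List.mem_cons.mp hv with rfl | hv
      · exact OnStick.child (ih' b (by simp)) (List.isChain_cons_cons.mp h2).1 (h1 _ (by simp))
      · exact ih' v hv

/-- A traversal that has never backtracked. -/
structure IsPathState (S : DFSState (Option (Fin n))) : Prop where
  stack_eq : S.stack = S.visited
  nodup : S.visited.Nodup
  isChain : S.visited.IsChain fun a b => S.parent a = some b
  getLast : S.visited.getLast? = some none
  mem_of_parent : ∀ w v, S.parent w = some v → w ∈ S.visited ∧ v ∈ S.visited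
  existsUnique : ∀ v ∈ S.visited.tail, ∃! w, S.parent w = some v
  leaf : ∀ v ∈ S.visited.head?, ∀ w, S.parent w ≠ some v

theorem isPathState_init : IsPathState (DFSState.init (none : Option (Fin n))) := by
  constructor <;> simp [DFSState.init]

/-- The previous head `v` had no child, so `w` becomes its only one. Vertices above `v` gain no
child because they differ from `v`. -/
theorem IsPathState.cons {S : DFSState (Option (Fin n))} (hS : IsPathState S)
    {v w : Option (Fin n)} {rest : List (Option (Fin n))} (hv : S.visited = v :: rest)
    (hw : w ∉ S.visited) :
    IsPathState { stack := w :: v :: rest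
                  visited := w :: S.visited
                  parent := Function.update S.parent w (some v) } := by
  obtain ⟨h1, h2, h3, h4, h5, h6, h7⟩ := hS
  constructor
  · simp [hv]
  · exact List.nodup_cons.mpr ⟨hw, h2⟩
  · simp only [hv, List.isChain_cons_cons, Function.update_self, true_and]
    rw [← hv]
    refine List.IsChain.imp_of_mem_imp (fun a b ha _ hab => ?_) h3
    rw [Function.update_of_ne (by rintro rfl; exact hw ha)]
    exact hab
  · simp only [hv] at h4 ⊢; simpa using h4
  · intro x y hxy
    simp only [List.mem_cons] at *
    by_cases hx : x = w
    · subst hx; simp at hxy; subst hxy; exact ⟨Or.inl rfl, Or.inr (by simp [hv])⟩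
    · rw [Function.update_of_ne hx] at hxy
      exact ⟨Or.inr (h5 _ _ hxy).1, Or.inr (h5 _ _ hxy).2⟩
  · intro x hx
    simp only [List.tail_cons, hv, List.mem_cons] at hx
    rcases hx with rfl | hx
    · refine ⟨w, by simp, fun y hy => ?_⟩
      by_contra hne
      simp only [Function.update_of_ne hne] at hy
      exact h7 x (by simp [hv]) y hy
    · obtain ⟨c, hc, huniq⟩ := h6 x (by simpa [hv] using hx)
      have hcw : c ≠ w := by rintro rfl; exact hw (h5 _ _ hc).1
      refine ⟨c, by simpa [Function.update_of_ne hcw] using hc, fun y hy => ?_⟩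
      by_cases hyw : y = w
      · subst hyw
        simp only [Function.update_self, Option.some.injEq] at hy
        subst hy
        rw [hv] at h2
        exact absurd hx (List.nodup_cons.mp h2).1
      · simp only [Function.update_of_ne hyw] at hy
        exact huniq y hy
  · intro x hx y hy
    simp only [List.head?_cons, Option.mem_def, Option.some.injEq] at hx
    subst hx
    by_cases hyw : y = w
    · subst hyw
      simp only [Function.update_self, Option.some.injEq] at hy
      subst hy
      exact hw (by simp [hv])
    · simp only [Function.update_of_ne hyw] at hy
      exact hw (h5 _ _ hy).2

theorem card_unvisitedSet {S : DFSState (Option (Fin n))} (h : S.visited.Nodup)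
    (h0 : none ∈ S.visited) : #(unvisitedSet S) + S.visited.length = n + 1 := by
  have h1 : #(S.visited.toFinset)ᶜ + #S.visited.toFinset = n + 1 := by
    rw [Finset.card_compl_add_card]; simp
  rw [List.toFinset_card_of_nodup h] at h1
  rw [← h1, ← card_map (Function.Embedding.some : Fin n ↪ Option (Fin n))]
  congr 2
  ext x
  rcases x with _ | x <;> simp [h0]

/-- As long as the unvisited part is connected, the traversal does not backtrack. -/
theorem isPathState_dfsRun (R : DFSRule n) (L : List (Sym2 (Fin n))) (J : ℕ) (hJ : J ≤ n)
    (h : ∀ i < J, CutConnected L (unvisitedSet (dfsRun R L i))) :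
    IsPathState (dfsRun R L J) ∧ (dfsRun R L J).visited.length = J + 1 ∧
      ∀ i, i + 1 = J → (dfsRun R L J).visited.tail = (dfsRun R L i).visited := by
  induction J with
  | zero => exact ⟨isPathState_init, rfl, by simp⟩
  | succ J ih =>
    obtain ⟨hP, hlen, htail⟩ := ih (by omega) fun i hi => h i (by omega)
    set S := dfsRun R L J with hS
    have h0 : none ∈ S.visited := List.mem_of_getLast? hP.getLast
    have hcard := card_unvisitedSet hP.nodup h0
    have hne : (unvisitedSet S).Nonempty := by
      rw [← card_pos]; omega
    obtain ⟨v, rest, hv⟩ : ∃ v rest, S.visited = v :: rest := by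
      rcases hq : S.visited with _ | ⟨v, rest⟩
      · simp [hq] at hlen
      · exact ⟨v, rest, rfl⟩
    have hnb : (unvisitedNeighbors L S.visited v).Nonempty := by
      rcases v with _ | a
      · obtain ⟨b, hb⟩ := hne
        refine ⟨some b, ?_⟩
        simpa [unvisitedNeighbors, augAdj] using hb
      · have hJ0 : J ≠ 0 := by
          rintro rfl
          simp only [hS, dfsRun, DFSState.init, Function.iterate_zero, id_eq, List.cons.injEq,
            reduceCtorEq, false_and] at hv
        obtain ⟨i, rfl⟩ : ∃ i, J = i + 1 := ⟨J - 1, by omega⟩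
        -- Connectivity is used one step back: the current vertex `a` was still unvisited after `i`
        -- steps, so the cut of `{a}` in that set supplies an edge to a vertex that is unvisited
        -- now.
        have hconn := h i (by omega)
        have ht := htail i rfl
        rw [hv, List.tail_cons] at ht
        have hnd := hP.nodup
        rw [hv] at hnd
        have haU : a ∈ unvisitedSet (dfsRun R L i) := by
          rw [mem_unvisitedSet, ← ht]
          exact (List.nodup_cons.mp hnd).1
        obtain ⟨b, hb⟩ := hne
        rw [mem_unvisitedSet, hv] at hb
        have hbU : b ∈ unvisitedSet (dfsRun R L i) := by
          rw [mem_unvisitedSet, ← ht]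
          exact fun hh => hb (List.mem_cons_of_mem _ hh)
        obtain ⟨a', ha', c, hc, hac⟩ := hconn {a} (by simpa using haU) (by simp) (by
          intro heq
          rw [← heq, mem_singleton] at hbU
          subst hbU; simp at hb)
        obtain rfl : a' = a := by simpa using ha'
        rw [mem_sdiff, mem_unvisitedSet, ← ht, mem_singleton] at hc
        refine ⟨some c, some_mem_unvisitedNeighbors hac (Ne.symm hc.2) ?_⟩
        rw [hv]
        simp [hc.1, hc.2]
    obtain ⟨w, hw, hstep⟩ := dfsStep_of_nonempty R L (hP.stack_eq.trans hv) hnb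
    have hwv : w ∉ S.visited := by simp [unvisitedNeighbors] at hw; exact hw.2
    rw [dfsRun_succ, ← hS, hstep]
    refine ⟨hP.cons hv hwv, by simp [hlen], fun i hi => ?_⟩
    obtain rfl : i = J := by omega
    rfl

/-- What is preserved once the traversal has moved down from the path `B`, whose children are
recorded in `p`: it does not return to `B` before everything is visited. -/
structure IsBelowPath (L : List (Sym2 (Fin n))) (B : List (Option (Fin n)))
    (p : Option (Fin n) → Option (Option (Fin n))) (S : DFSState (Option (Fin n))) : Prop where
  stack_subset : S.stack ⊆ S.visited
  subset_visited : B ⊆ S.visited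
  parent_iff : ∀ w, ∀ v ∈ B, S.parent w = some v ↔ p w = some v
  mem_of_parent : ∀ w v, S.parent w = some v → w ∈ S.visited
  finished : ∀ x ∈ S.visited, x ∉ S.stack → unvisitedNeighbors L S.visited x = ∅
  below : (∀ x, x ∈ S.visited) ∨ ∃ l, l ≠ [] ∧ S.stack = l ++ B ∧ ∀ x ∈ l, x ∉ B

theorem unvisitedNeighbors_cons_subset (L : List (Sym2 (Fin n))) (W : List (Option (Fin n)))
    (v w : Option (Fin n)) : unvisitedNeighbors L (w :: W) v ⊆ unvisitedNeighbors L W v := by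
  intro x
  simp only [unvisitedNeighbors, mem_filter, List.mem_cons]
  tauto

/-- The only danger is backtracking into `B` too early. At that moment all visited vertices outside
`B` are finished, so no edge joins them to unvisited vertices; connectivity of the complement of `B`
then leaves nothing unvisited. -/
theorem IsBelowPath.step (R : DFSRule n) {L : List (Sym2 (Fin n))} {B : List (Option (Fin n))}
    {p : Option (Fin n) → Option (Option (Fin n))} {S : DFSState (Option (Fin n))}
    (hB : none ∈ B) (hL : ∀ a : Fin n, s(a, a) ∉ L)
    (hconn : CutConnected L (univ.filter fun v => some v ∉ B))
    (hS : IsBelowPath L B p S) : IsBelowPath L B p (dfsStep R L S) := by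
  obtain ⟨h1, h2, h3, h4, h5, h6⟩ := hS
  rcases hst : S.stack with _ | ⟨v, rest⟩
  · rw [dfsStep_of_nil R L hst]; exact ⟨h1, h2, h3, h4, h5, h6⟩
  by_cases hne : (unvisitedNeighbors L S.visited v).Nonempty
  · obtain ⟨w, hw, hstep⟩ := dfsStep_of_nonempty R L hst hne
    have hwv : w ∉ S.visited := by simp [unvisitedNeighbors] at hw; exact hw.2
    rcases h6 with h6 | ⟨l, hl, hlB, hlx⟩
    · exact absurd (h6 w) hwv
    obtain ⟨x, l', rfl⟩ := List.exists_cons_of_ne_nil hl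
    rw [hst, List.cons_append, List.cons.injEq] at hlB
    obtain ⟨rfl, rfl⟩ := hlB
    have hvB : v ∉ B := hlx v (by simp)
    have hwB : w ∉ B := fun hh => hwv (h2 hh)
    rw [hstep]
    rw [hst] at h1 h5
    refine ⟨List.cons_subset_cons _ h1, fun x hx => List.mem_cons_of_mem _ (h2 hx), ?_, ?_, ?_,
      Or.inr ⟨w :: v :: l', by simp, by simp, ?_⟩⟩
    · intro u y hy
      by_cases huw : u = w
      · subst huw
        simp only [Function.update_self, Option.some.injEq]
        constructor
        · rintro rfl; exact absurd hy hvB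
        · intro hp
          exact absurd (h4 _ _ ((h3 u y hy).mpr hp)) hwv
      · simp only [Function.update_of_ne huw]; exact h3 u y hy
    · intro u y hy
      by_cases huw : u = w
      · subst huw; simp
      · simp only [Function.update_of_ne huw] at hy
        exact List.mem_cons_of_mem _ (h4 u y hy)
    · intro x hx hxs
      simp only [List.mem_cons, not_or] at hx hxs
      have := h5 x (hx.resolve_left hxs.1) (by simpa using hxs.2)
      exact subset_empty.mp (this ▸ unvisitedNeighbors_cons_subset L S.visited x w)
    · intro x hx
      rcases List.mem_cons.mp hx with rfl | hx
      · exact hwB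
      · exact hlx x hx
  · rw [dfsStep_of_empty R L hst hne]
    rw [not_nonempty_iff_eq_empty] at hne
    rw [hst] at h1 h5 h6
    have h5' : ∀ x ∈ S.visited, x ∉ rest → unvisitedNeighbors L S.visited x = ∅ := by
      intro x hx hxs
      by_cases hxv : x = v
      · subst hxv; exact hne
      · exact h5 x hx (by simp [hxv, hxs])
    refine ⟨fun x hx => h1 (List.mem_cons_of_mem _ hx), h2, h3, h4, h5', ?_⟩
    rcases h6 with h6 | ⟨l, hl, hlB, hlx⟩
    · exact Or.inl h6
    obtain ⟨x, l', rfl⟩ := List.exists_cons_of_ne_nil hl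
    rw [List.cons_append, List.cons.injEq] at hlB
    obtain ⟨rfl, rfl⟩ := hlB
    rcases l' with _ | ⟨y, l'⟩
    -- The last vertex below `B` is being popped. If some `z` were unvisited, the visited vertices
    -- outside `B` would form a proper nonempty part of the complement of `B`, and the edge leaving
    -- it would contradict `h5'`.
    · left
      have hvB : v ∉ B := hlx v (by simp)
      have hvv : v ∈ S.visited := h1 (by simp)
      rcases v with _ | a
      · exact absurd hB hvB
      by_contra! hcon
      obtain ⟨z, hz⟩ := hcon
      rcases z with _ | z
      · exact hz (h2 hB)
      obtain ⟨c, hc, d, hd, hcd⟩ := hconn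
        (univ.filter fun u => some u ∉ B ∧ some u ∈ S.visited)
        (fun u hu => by simp only [mem_filter, mem_univ, true_and] at hu ⊢; exact hu.1)
        ⟨a, by simp [hvB, hvv]⟩
        (by
          intro heq
          have : z ∈ univ.filter fun v => some v ∉ B := by
            simp only [mem_filter, mem_univ, true_and]; exact fun hh => hz (h2 hh)
          rw [← heq] at this
          simp only [mem_filter, mem_univ, true_and] at this
          exact hz this.2)
      simp only [mem_filter, mem_univ, true_and, mem_sdiff, not_and] at hc hd
      have hemp := h5' (some c) hc.2 (by simpa using hc.1)
      have hmem := some_mem_unvisitedNeighbors hcd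
        (by rintro rfl; exact hL _ hcd) (hd.2 hd.1)
      rw [hemp] at hmem
      simp at hmem
    · exact Or.inr ⟨y :: l', by simp, rfl, fun x hx => hlx x (List.mem_cons_of_mem _ hx)⟩

/-- If the unvisited part is connected during the first `J` steps, then the vertices visited by
then lie on the stick. -/
theorem onStick_of_cutConnected (R : DFSRule n) (L : List (Sym2 (Fin n)))
    (hL : ∀ a : Fin n, s(a, a) ∉ L) (J : ℕ) (hJ : J < n)
    (h : ∀ i ≤ J, CutConnected L (unvisitedSet (dfsRun R L i))) :
    ∀ v ∈ (dfsRun R L J).visited, OnStick (dfsTree R L) none v := by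
  -- The run is followed for one step beyond `J`, because the last vertex of the path `B` receives
  -- its only child in that step.
  obtain ⟨hP, hlen, htail⟩ := isPathState_dfsRun R L (J + 1) hJ fun i hi => h i (by omega)
  have htail := htail J rfl
  set B := (dfsRun R L J).visited with hB
  set S := dfsRun R L (J + 1) with hS
  obtain ⟨hP0, -, -⟩ := isPathState_dfsRun R L J hJ.le fun i hi => h i (by omega)
  have hBnone : none ∈ B := List.mem_of_getLast? hP0.getLast
  obtain ⟨v, hv⟩ : ∃ v, S.visited = v :: B := by
    rcases hq : S.visited with _ | ⟨v, rest⟩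
    · simp [hq] at hlen
    · rw [hq, List.tail_cons] at htail; exact ⟨v, by rw [htail]⟩
  have hbase : IsBelowPath L B S.parent S := by
    refine ⟨by rw [hP.stack_eq]; exact fun _ => id, by rw [hv]; exact List.subset_cons_self _ _,
      fun _ _ _ => Iff.rfl, fun w v hw => (hP.mem_of_parent w v hw).1, ?_,
      Or.inr ⟨[v], by simp, by rw [hP.stack_eq, hv]; rfl, ?_⟩⟩
    · intro x hx hxs; rw [hP.stack_eq] at hxs; exact absurd hx hxs
    · intro x hx
      obtain rfl : x = v := by simpa using hx
      have := hP.nodup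
      rw [hv] at this
      exact (List.nodup_cons.mp this).1
  have hall : ∀ k, IsBelowPath L B S.parent (dfsRun R L (J + 1 + k)) := by
    intro k
    induction k with
    | zero => exact hbase
    | succ k ih =>
      rw [← add_assoc, dfsRun_succ]
      exact ih.step R hBnone hL (h J le_rfl)
  have hfin := hall (2 * n - J)
  rw [show J + 1 + (2 * n - J) = 2 * n + 1 by omega] at hfin
  have hpar : ∀ w, ∀ v ∈ B, dfsTree R L w = some v ↔ S.parent w = some v := hfin.parent_iff
  refine onStick_of_isChain B ?_ ?_ hP0.getLast
  · intro v hvB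
    obtain ⟨w, hw, hu⟩ := hP.existsUnique v (by rw [hv]; exact hvB)
    exact ⟨w, (hpar w v hvB).mpr hw, fun y hy => hu y ((hpar y v hvB).mp hy)⟩
  · have hch := hP.isChain
    rw [hv] at hch
    exact List.IsChain.imp_of_mem_imp (fun a b _ hb hab => (hpar a b hb).mpr hab) hch.of_cons

theorem card_unvisitedSet_dfsRun (R : DFSRule n) (L : List (Sym2 (Fin n))) (J : ℕ) (hJ : J ≤ n)
    (h : ∀ i < J, CutConnected L (unvisitedSet (dfsRun R L i))) :
    #(unvisitedSet (dfsRun R L J)) = n - J := by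
  obtain ⟨hP, hlen, -⟩ := isPathState_dfsRun R L J hJ h
  have := card_unvisitedSet hP.nodup (List.mem_of_getLast? hP.getLast)
  omega

end Traversal

/-! ### Random insertions: connectivity of the unvisited part and the probability of hitting the
bristles. -/

section RandomInsertions

open Classical in
/-- The possible edges with both endpoints in `U`. -/
noncomputable def innerEdges {n : ℕ} (U : Finset (Fin n)) :
    Finset {e : Sym2 (Fin n) // ¬ e.IsDiag} :=
  univ.filter fun e => ∀ a ∈ e.1, a ∈ U

variable {n : ℕ}

theorem mem_innerEdges {U : Finset (Fin n)} {e : {e : Sym2 (Fin n) // ¬ e.IsDiag}} :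
    e ∈ innerEdges U ↔ ∀ a ∈ e.1, a ∈ U := by
  simp [innerEdges]

theorem card_innerEdges (U : Finset (Fin n)) : #(innerEdges U) = (#U).choose 2 := by
  classical
  rw [← Sym2.card_image_offDiag, ← card_map (Function.Embedding.subtype _)]
  congr 1
  ext e
  induction e using Sym2.ind with
  | _ a b =>
    simp only [mem_map, mem_innerEdges, Function.Embedding.coe_subtype, Subtype.exists,
      exists_and_left, exists_prop, mem_image, mem_offDiag, Prod.exists]
    constructor
    · rintro ⟨e, he, hd, rfl⟩
      exact ⟨a, b, ⟨he a (by simp), he b (by simp), by simpa using hd⟩, rfl⟩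
    · rintro ⟨c, d, ⟨hc, hd, hne⟩, heq⟩
      refine ⟨s(a, b), ?_, ?_, rfl⟩
      · change s(c, d) = s(a, b) at heq
        rw [← heq]; intro x hx
        rcases Sym2.mem_iff.mp hx with rfl | rfl <;> assumption
      · change s(c, d) = s(a, b) at heq
        rw [← heq]; simpa using hne

theorem mem_insertedBefore {σ : InsertionSeq n} {t : ℕ} {e : Sym2 (Fin n)} :
    e ∈ insertedBefore σ t ↔ ∃ i : Fin (n.choose 2), (i : ℕ) < t ∧ (σ i : Sym2 (Fin n)) = e := by
  unfold insertedBefore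
  rw [List.mem_take_iff_getElem]
  constructor
  · rintro ⟨i, hi, rfl⟩
    simp only [List.length_ofFn, lt_min_iff] at hi
    exact ⟨⟨i, hi.2⟩, hi.1, by simp⟩
  · rintro ⟨i, hi, rfl⟩
    exact ⟨i, by simp [hi, i.2], by simp⟩

/-- Both exchanged edges avoid `W`, so their entries are hidden before and after the exchange. This
is the principle of deferred decisions. -/
theorem exploredPart_swap {σ : InsertionSeq n} {t : ℕ} {W : List (Option (Fin n))}
    {U : Finset (Fin n)} (hU : ∀ a ∈ U, some a ∉ W) {x y : {e : Sym2 (Fin n) // ¬ e.IsDiag}}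
    (hx : x ∈ innerEdges U) (hy : y ∈ innerEdges U) :
    exploredPart (insertedBefore σ t) W
      = exploredPart (insertedBefore (σ.trans (Equiv.swap x y)) t) W := by
  unfold exploredPart insertedBefore
  rw [List.map_take, List.map_take, List.map_ofFn, List.map_ofFn]
  have hin : ∀ z ∈ innerEdges U, ¬ ∃ a ∈ z.1, some a ∈ W := by
    rintro z hz ⟨a, ha, haW⟩
    exact hU a (mem_innerEdges.mp hz a ha) haW
  have key : ∀ z z' : Sym2 (Fin n),
      (z = z' ∨ (¬ ∃ a ∈ z, some a ∈ W) ∧ ¬ ∃ a ∈ z', some a ∈ W) →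
      (if ∃ a ∈ z, some a ∈ W then some z else none)
        = if ∃ a ∈ z', some a ∈ W then some z' else none := by
    rintro z z' (rfl | ⟨h1, h2⟩)
    · rfl
    · rw [if_neg h1, if_neg h2]
  congr 2
  funext i
  refine key (σ i) (Equiv.swap x y (σ i)) ?_
  by_cases h1 : σ i = x
  · rw [h1, Equiv.swap_apply_left]
    exact Or.inr ⟨hin x hx, hin y hy⟩
  · by_cases h2 : σ i = y
    · rw [h2, Equiv.swap_apply_right]
      exact Or.inr ⟨hin y hy, hin x hx⟩
    · rw [Equiv.swap_apply_of_ne_of_ne h1 h2]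
      exact Or.inl rfl

/-- Exchangeability of the future: anything computed from the first `t` edges is independent of the
order of the later ones. -/
theorem insertedBefore_swap_trans {σ : InsertionSeq n} {t : ℕ} {x y : Fin (n.choose 2)}
    (hx : t ≤ x) (hy : t ≤ y) :
    insertedBefore ((Equiv.swap x y).trans σ) t = insertedBefore σ t := by
  refine List.ext_getElem (by simp [insertedBefore]) fun i h1 h2 => ?_
  simp only [insertedBefore, List.length_take, List.length_ofFn, lt_min_iff] at h1
  simp only [insertedBefore, List.getElem_take, List.getElem_ofFn, Equiv.trans_apply]
  rw [Equiv.swap_apply_of_ne_of_ne]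
  · intro h; rw [← h] at hx; simp at hx; omega
  · intro h; rw [← h] at hy; simp at hy; omega

/-- The positions before time `t`. -/
def earlyPositions (n t : ℕ) : Finset (Fin (n.choose 2)) :=
  univ.filter fun i => (i : ℕ) < t

theorem card_earlyPositions {t : ℕ} (ht : t ≤ n.choose 2) : #(earlyPositions n t) = t := by
  rw [earlyPositions, Fin.card_filter_val_lt, min_eq_right ht]

/-- The sum is `(1 + x) ^ #U - 1 ≤ exp (#U * x) - 1`. It serves the union bounds over vertex sets,
whose failure probabilities decay geometrically in the size. -/
theorem sum_nonempty_powerset_pow_le {α : Type} [DecidableEq α] (U : Finset α) (x : ℝ)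
    (hx : 0 ≤ x) (hUx : #U * x ≤ 1) :
    ∑ A ∈ U.powerset with A.Nonempty, x ^ #A ≤ 2 * (#U * x) := by
  have h1 : ∑ A ∈ U.powerset, x ^ #A = (x + 1) ^ #U := by
    rw [← sum_pow_mul_eq_add_pow]; simp
  have h2 : ∑ A ∈ U.powerset, x ^ #A = (∑ A ∈ U.powerset with A.Nonempty, x ^ #A) + 1 := by
    rw [← sum_filter_add_sum_filter_not U.powerset (fun A => A.Nonempty)]
    congr 1
    have : (U.powerset.filter fun A => ¬ A.Nonempty) = {∅} := by
      ext A; simp only [mem_filter, mem_powerset, not_nonempty_iff_eq_empty, mem_singleton]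
      constructor
      · exact fun h => h.2
      · rintro rfl; simp
    rw [this]; simp
  have h3 : (x + 1) ^ #U ≤ Real.exp (#U * x) := by
    rw [Real.exp_nat_mul]
    exact pow_le_pow_left₀ (by linarith) (Real.add_one_le_exp x) _
  have h4 : 0 ≤ #U * x := by positivity
  have h5 := Real.abs_exp_sub_one_le (x := #U * x) (by rwa [abs_of_nonneg h4])
  rw [abs_of_nonneg h4] at h5
  have := le_abs_self (Real.exp (#U * x) - 1)
  linarith

/-- Choosing the smaller side gives at least `#A * #U / 2` cut edges, so the cost of a cut is
exponential in `#A`. -/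
theorem exists_small_cut {L : List (Sym2 (Fin n))} {U : Finset (Fin n)} (h : ¬ CutConnected L U) :
    ∃ A ⊆ U, A.Nonempty ∧ 2 * #A ≤ #U ∧ ∀ a ∈ A, ∀ b ∈ U \ A, s(a, b) ∉ L := by
  unfold CutConnected at h
  push Not at h
  obtain ⟨A, hAU, hA, hne, hcut⟩ := h
  by_cases hc : 2 * #A ≤ #U
  · exact ⟨A, hAU, hA, hc, hcut⟩
  · refine ⟨U \ A, sdiff_subset, ?_, ?_, ?_⟩
    · rw [sdiff_nonempty]
      exact fun h => hne (hAU.antisymm h)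
    · rw [card_sdiff_of_subset hAU]; omega
    · intro a ha b hb
      rw [Finset.sdiff_sdiff_eq_self hAU] at hb
      rw [Sym2.eq_swap]
      exact hcut b hb a ha

open Classical in
/-- The possible edges between `A` and `U \ A`. -/
noncomputable def cutEdges (U A : Finset (Fin n)) : Finset {e : Sym2 (Fin n) // ¬ e.IsDiag} :=
  univ.filter fun e => ∃ a ∈ A, ∃ b ∈ U \ A, e.1 = s(a, b)

theorem cutEdges_subset {U A : Finset (Fin n)} (hA : A ⊆ U) : cutEdges U A ⊆ innerEdges U := by
  intro e he
  simp only [cutEdges, mem_filter, mem_univ, true_and] at he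
  obtain ⟨a, ha, b, hb, heq⟩ := he
  rw [mem_innerEdges, heq]
  intro x hx
  rcases Sym2.mem_iff.mp hx with rfl | rfl
  · exact hA ha
  · exact (mem_sdiff.mp hb).1

theorem card_cutEdges_ge (U A : Finset (Fin n)) : #A * #(U \ A) ≤ #(cutEdges U A) := by
  rw [← card_product]
  have hne : ∀ p ∈ A ×ˢ (U \ A), p.1 ≠ p.2 := by
    intro p hp heq
    simp only [mem_product, mem_sdiff] at hp
    exact hp.2.2 (heq ▸ hp.1)
  rw [← card_map (Function.Embedding.subtype _)]
  refine card_le_card_of_injOn (fun p => s(p.1, p.2)) ?_ ?_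
  · intro p hp
    have hp' := mem_product.mp hp
    simp only [coe_map, Function.Embedding.coe_subtype, Set.mem_image, mem_coe]
    exact ⟨⟨s(p.1, p.2), by simpa using hne p hp⟩, by
      simp only [cutEdges, mem_filter, mem_univ, true_and]
      exact ⟨p.1, hp'.1, p.2, hp'.2, rfl⟩, rfl⟩
  · intro p hp q hq hpq
    have hp' := mem_product.mp hp
    have hq' := mem_product.mp hq
    rcases Sym2.eq_iff.mp hpq with ⟨h1, h2⟩ | ⟨h1, h2⟩
    · exact Prod.ext h1 h2
    · rw [h1] at hp'
      exact absurd hp'.1 (mem_sdiff.mp hq'.2).2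

open Classical in
/-- A set of hidden edges that has not become too sparse is unlikely to be disconnected. -/
theorem card_not_cutConnected_le (R : DFSRule n) (t i : ℕ) (U : Finset (Fin n)) (κ : ℝ)
    (hκ0 : 0 ≤ κ) (hκ : κ ≤ 1) (hU : #U * Real.exp (-(κ * #U / 2)) ≤ 1) :
    (#{σ : InsertionSeq n | unvisitedSet (dfsRun R (insertedBefore σ t) i) = U ∧
        κ * #(innerEdges U) ≤ #{e ∈ innerEdges U | σ.symm e ∈ earlyPositions n t} ∧
        ¬ CutConnected (insertedBefore σ t) U} : ℝ)
      ≤ 2 * (#U * Real.exp (-(κ * #U / 2))) *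
        #{σ : InsertionSeq n | unvisitedSet (dfsRun R (insertedBefore σ t) i) = U} := by
  set x := Real.exp (-(κ * #U / 2)) with hx
  set S : Finset (InsertionSeq n) :=
    {σ | unvisitedSet (dfsRun R (insertedBefore σ t) i) = U ∧
      κ * #(innerEdges U) ≤ #{e ∈ innerEdges U | σ.symm e ∈ earlyPositions n t}} with hS
  have hSinv : ∀ σ ∈ S, ∀ x ∈ innerEdges U, ∀ y ∈ innerEdges U,
      σ.trans (Equiv.swap x y) ∈ S := by
    intro σ hσ x hx y hy
    simp only [hS, mem_filter, mem_univ, true_and] at hσ ⊢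
    obtain ⟨h1, h2⟩ := hσ
    constructor
    -- The exchange is invisible to the first `i` steps, hence the unvisited set is still `U`.
    · rw [dfsRun_congr R i (exploredPart_swap (U := U) ?_ hx hy)]
      · exact h1
      · intro a ha
        rw [← h1] at ha
        simpa using ha
    · refine h2.trans (le_of_eq ?_)
      congr 1
      refine card_bij' (fun e _ => Equiv.swap x y e) (fun e _ => Equiv.swap x y e) ?_ ?_
        (by simp) (by simp)
      all_goals
        intro e he
        simp only [mem_filter] at he ⊢
        refine ⟨?_, by simpa [Equiv.symm_trans_apply] using he.2⟩
        rw [Equiv.swap_apply_def]; split_ifs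
        · exact hy
        · exact hx
        · exact he.1
  have hcut : ∀ A ∈ U.powerset.filter fun A => A.Nonempty,
      (#{σ ∈ S | 2 * #A ≤ #U ∧ ∀ e ∈ cutEdges U A, σ.symm e ∉ earlyPositions n t} : ℝ)
        ≤ x ^ #A * #S := by
    intro A hA
    simp only [mem_filter, mem_powerset] at hA
    by_cases h2 : 2 * #A ≤ #U
    · simp only [h2, true_and]
      refine (card_avoid_le S (innerEdges U) (earlyPositions n t) κ hκ hSinv
        (fun σ hσ => by simp only [hS, mem_filter, mem_univ, true_and] at hσ; exact hσ.2) _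
        (cutEdges_subset hA.1)).trans ?_
      refine mul_le_mul_of_nonneg_right ?_ (by positivity)
      have h3 : (1 - κ) ^ #(cutEdges U A) ≤ Real.exp (-κ) ^ #(cutEdges U A) := by
        refine pow_le_pow_left₀ (by linarith) ?_ _
        have := Real.add_one_le_exp (-κ); linarith
      refine h3.trans ?_
      rw [hx, ← Real.exp_nat_mul, ← Real.exp_nat_mul]
      apply Real.exp_le_exp.mpr
      have h4 : (#A : ℝ) * #(U \ A) ≤ #(cutEdges U A) := by
        exact_mod_cast card_cutEdges_ge U A
      have h5 : (#(U \ A) : ℝ) = #U - #A := by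
        rw [card_sdiff_of_subset hA.1, Nat.cast_sub (card_le_card hA.1)]
      have h6 : 2 * (#A : ℝ) ≤ #U := by exact_mod_cast h2
      have h7 : (#A : ℝ) * (#U / 2) ≤ #(cutEdges U A) := by
        refine le_trans ?_ h4
        apply mul_le_mul_of_nonneg_left _ (by positivity)
        rw [h5]; linarith
      nlinarith
    · simp only [h2, false_and, filter_false, card_empty, Nat.cast_zero]
      positivity
  have hsub : ({σ : InsertionSeq n | unvisitedSet (dfsRun R (insertedBefore σ t) i) = U ∧
        κ * #(innerEdges U) ≤ #{e ∈ innerEdges U | σ.symm e ∈ earlyPositions n t} ∧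
        ¬ CutConnected (insertedBefore σ t) U} : Finset (InsertionSeq n)) ⊆
      (U.powerset.filter fun A => A.Nonempty).biUnion fun A =>
        {σ ∈ S | 2 * #A ≤ #U ∧ ∀ e ∈ cutEdges U A, σ.symm e ∉ earlyPositions n t} := by
    intro σ hσ
    simp only [mem_filter, mem_univ, true_and] at hσ
    obtain ⟨h1, h2, h3⟩ := hσ
    obtain ⟨A, hAU, hA, hA2, hAc⟩ := exists_small_cut h3
    simp only [mem_biUnion, mem_filter, mem_powerset]
    refine ⟨A, ⟨hAU, hA⟩, by simp only [hS, mem_filter, mem_univ, true_and]; exact ⟨h1, h2⟩,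
      hA2, ?_⟩
    intro e he hpos
    simp only [cutEdges, mem_filter, mem_univ, true_and] at he
    obtain ⟨a, ha, b, hb, heq⟩ := he
    refine hAc a ha b hb ?_
    rw [mem_insertedBefore]
    exact ⟨σ.symm e, by simpa [earlyPositions] using hpos, by rw [Equiv.apply_symm_apply, heq]⟩
  have hSle : (#S : ℝ) ≤
      #{σ : InsertionSeq n | unvisitedSet (dfsRun R (insertedBefore σ t) i) = U} := by
    exact_mod_cast card_le_card fun σ hσ => by
      simp only [hS, mem_filter, mem_univ, true_and] at hσ ⊢; exact hσ.1
  calc _ ≤ ((∑ A ∈ U.powerset with A.Nonempty,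
        #{σ ∈ S | 2 * #A ≤ #U ∧ ∀ e ∈ cutEdges U A, σ.symm e ∉ earlyPositions n t} : ℕ) : ℝ) := by
        exact_mod_cast (card_le_card hsub).trans card_biUnion_le
    _ ≤ ∑ A ∈ U.powerset with A.Nonempty, x ^ #A * #S := by
        push_cast; exact sum_le_sum hcut
    _ = (∑ A ∈ U.powerset with A.Nonempty, x ^ #A) * #S := by rw [sum_mul]
    _ ≤ 2 * (#U * x) * #S :=
        mul_le_mul_of_nonneg_right
          (sum_nonempty_powerset_pow_le U x (Real.exp_pos _).le hU) (by positivity)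
    _ ≤ _ := mul_le_mul_of_nonneg_left hSle (by positivity)

open Classical in
/-- It is unlikely that the traversal meets a disconnected unvisited part with at least `r`
vertices. -/
theorem card_exists_not_cutConnected_le (R : DFSRule n) (t r : ℕ) (hn : 2 ≤ n)
    (ht : t ≤ n.choose 2) (hr : 2 ≤ r) (hrn : r ≤ n)
    (hrt : 16 * Real.log n ≤ r * (t / (8 * n.choose 2))) :
    (#{σ : InsertionSeq n | ∃ i ≤ n - r, ¬ CutConnected (insertedBefore σ t)
        (unvisitedSet (dfsRun R (insertedBefore σ t) i))} : ℝ)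
      ≤ 4 / (n : ℝ) ^ 2 * Fintype.card (InsertionSeq n) := by
  set κ : ℝ := t / (8 * n.choose 2) with hκ
  set T : ℝ := ((Fintype.card (InsertionSeq n) : ℕ) : ℝ) with hT
  have hn0 : (0 : ℝ) < n := by positivity
  have hn2 : (2 : ℝ) ≤ n := by exact_mod_cast hn
  set ℓ := Real.log n with hℓ
  have hℓ0 : 0 ≤ ℓ := Real.log_nonneg (by linarith)
  set y := Real.exp (-(4 * ℓ)) with hy
  have hyn : y = 1 / (n : ℝ) ^ 4 := by
    rw [hy, Real.exp_neg, show 4 * ℓ = ((4 : ℕ) : ℝ) * ℓ by norm_num, Real.exp_nat_mul,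
      Real.exp_log hn0, one_div]
  have hny : n * y ≤ 1 := by
    rw [hyn, mul_one_div, div_le_one (by positivity)]
    calc (n : ℝ) = n ^ 1 := (pow_one _).symm
      _ ≤ n ^ 4 := pow_le_pow_right₀ (by linarith) (by norm_num)
  have hκ0 : 0 ≤ κ := by positivity
  have hκ1 : κ ≤ 1 := by
    apply div_le_one_of_le₀ _ (by positivity)
    have : (t : ℝ) ≤ n.choose 2 := by exact_mod_cast ht
    linarith
  have hcardB : Fintype.card {e : Sym2 (Fin n) // ¬ e.IsDiag} = n.choose 2 := by
    rw [Sym2.card_subtype_not_diag, Fintype.card_fin]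
  have hUn : ∀ U : Finset (Fin n), (#U : ℝ) ≤ n := fun U => by
    exact_mod_cast (card_le_univ U).trans (by simp)
  have hUκ : ∀ U : Finset (Fin n), r ≤ #U → 16 * ℓ ≤ κ * #U := by
    intro U hU
    refine hrt.trans ?_
    rw [mul_comm]
    exact mul_le_mul_of_nonneg_left (by exact_mod_cast hU) hκ0
  -- The tail exponent is `κ * (#U).choose 2 ≥ κ * #U ^ 2 / 4 ≥ 4 * ℓ * #U`, using `#U ≥ 2` and `κ *
  -- #U ≥ 16 * ℓ`. The bound `y ^ #U` survives a union over all `U`.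
  have hsparse : ∀ U : Finset (Fin n), r ≤ #U →
      (#{σ : InsertionSeq n | (#{e ∈ innerEdges U | σ.symm e ∈ earlyPositions n t} : ℝ)
        ≤ κ * #(innerEdges U)} : ℝ) ≤ y ^ #U * T := by
    intro U hU
    have := card_lower_tail_le (A := Fin (n.choose 2)) (innerEdges U) (earlyPositions n t)
    rw [card_earlyPositions ht, hcardB, ← hκ, mul_comm (#(innerEdges U) : ℝ) κ] at this
    refine this.trans (mul_le_mul_of_nonneg_right ?_ (by positivity))
    rw [hy, ← Real.exp_nat_mul]
    apply Real.exp_le_exp.mpr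
    rw [card_innerEdges, Nat.cast_choose_two]
    have h1 := hUκ U hU
    have h2 : (2 : ℝ) ≤ #U := by exact_mod_cast hr.trans hU
    have h3 : (#U : ℝ) * (4 * ℓ) ≤ #U * (κ * #U / 4) := by
      apply mul_le_mul_of_nonneg_left _ (by positivity); linarith
    have h4 : κ * (#U : ℝ) * (#U / 4) ≤ κ * #U * ((#U - 1) / 2) := by
      apply mul_le_mul_of_nonneg_left _ (by positivity); linarith
    nlinarith
  have hdisc : ∀ i, ∀ U : Finset (Fin n), r ≤ #U →
      (#{σ : InsertionSeq n | unvisitedSet (dfsRun R (insertedBefore σ t) i) = U ∧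
        κ * #(innerEdges U) ≤ #{e ∈ innerEdges U | σ.symm e ∈ earlyPositions n t} ∧
        ¬ CutConnected (insertedBefore σ t) U} : ℝ) ≤ 2 * (n * y) *
        #{σ : InsertionSeq n | unvisitedSet (dfsRun R (insertedBefore σ t) i) = U} := by
    intro i U hU
    have h1 : Real.exp (-(κ * #U / 2)) ≤ y := by
      rw [hy]; apply Real.exp_le_exp.mpr
      have := hUκ U hU
      linarith
    have h2 : (#U : ℝ) * Real.exp (-(κ * #U / 2)) ≤ n * y :=
      mul_le_mul (hUn U) h1 (Real.exp_pos _).le hn0.le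
    refine (card_not_cutConnected_le R t i U κ hκ0 hκ1 (h2.trans hny)).trans ?_
    exact mul_le_mul_of_nonneg_right (by linarith) (by positivity)
  set P : Finset (Finset (Fin n)) := (univ : Finset (Fin n)).powerset.filter
    fun A => A.Nonempty with hP
  set F1 : Finset (Fin n) → Finset (InsertionSeq n) := fun U => if r ≤ #U then
    ({σ : InsertionSeq n | (#{e ∈ innerEdges U | σ.symm e ∈ earlyPositions n t} : ℝ)
      ≤ κ * #(innerEdges U)} : Finset (InsertionSeq n)) else ∅ with hF1
  set F2 : ℕ → Finset (Fin n) → Finset (InsertionSeq n) := fun i U => if r ≤ #U then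
    ({σ : InsertionSeq n | unvisitedSet (dfsRun R (insertedBefore σ t) i) = U ∧
        κ * #(innerEdges U) ≤ #{e ∈ innerEdges U | σ.symm e ∈ earlyPositions n t} ∧
        ¬ CutConnected (insertedBefore σ t) U} : Finset (InsertionSeq n)) else ∅ with hF2
  have hsub : ({σ : InsertionSeq n | ∃ i ≤ n - r, ¬ CutConnected (insertedBefore σ t)
        (unvisitedSet (dfsRun R (insertedBefore σ t) i))} : Finset (InsertionSeq n)) ⊆
      P.biUnion F1 ∪ (range n).biUnion fun i => univ.biUnion (F2 i) := by
    intro σ hσ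
    simp only [mem_filter, mem_univ, true_and] at hσ
    have hex : ∃ i, i ≤ n - r ∧ ¬ CutConnected (insertedBefore σ t)
        (unvisitedSet (dfsRun R (insertedBefore σ t) i)) := hσ
    -- At the first failure the traversal is still a path, so `#U = n - i ≥ r`.
    obtain ⟨hi1, hi2⟩ := Nat.find_spec hex
    have hmin : ∀ j < Nat.find hex, CutConnected (insertedBefore σ t)
        (unvisitedSet (dfsRun R (insertedBefore σ t) j)) := by
      intro j hj
      have := Nat.find_min hex hj
      by_contra hcon
      exact this ⟨by omega, hcon⟩
    set i := Nat.find hex with hi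
    set U := unvisitedSet (dfsRun R (insertedBefore σ t) i) with hU
    have hcard : #U = n - i := card_unvisitedSet_dfsRun R _ i (by omega) hmin
    have hUne : U.Nonempty := by
      rcases U.eq_empty_or_nonempty with h | h
      · exfalso; apply hi2; rw [h]
        intro A hA hAne hne
        exact absurd (subset_empty.mp hA) hne
      · exact h
    have hpos := card_pos.mpr hUne
    by_cases hrU : r ≤ #U
    · rw [mem_union]
      by_cases hκU : κ * #(innerEdges U) ≤ #{e ∈ innerEdges U | σ.symm e ∈ earlyPositions n t}
      · right
        simp only [mem_biUnion, mem_range, mem_univ, true_and]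
        refine ⟨i, by omega, U, ?_⟩
        simp only [hF2, if_pos hrU, mem_filter, mem_univ, true_and]
        exact ⟨rfl, hκU, hi2⟩
      · left
        simp only [mem_biUnion]
        refine ⟨U, by simp [hP, hUne], ?_⟩
        simp only [hF1, if_pos hrU, mem_filter, mem_univ, true_and]
        exact (not_le.mp hκU).le
    · omega
  have hc1 : (#(P.biUnion F1) : ℝ) ≤ 2 * (n * y) * T := by
    calc (#(P.biUnion F1) : ℝ) ≤ ((∑ U ∈ P, #(F1 U) : ℕ) : ℝ) := by
          exact_mod_cast card_biUnion_le
      _ ≤ ∑ U ∈ P, y ^ #U * T := by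
          push_cast
          refine sum_le_sum fun U _ => ?_
          simp only [hF1]
          split_ifs with h
          · exact hsparse U h
          · simp only [card_empty, Nat.cast_zero]; positivity
      _ = (∑ U ∈ P, y ^ #U) * T := by rw [sum_mul]
      _ ≤ _ := by
          refine mul_le_mul_of_nonneg_right ?_ (by positivity)
          have := sum_nonempty_powerset_pow_le (univ : Finset (Fin n)) y (Real.exp_pos _).le
            (by simpa using hny)
          simpa [hP] using this
  have hc2 : (#((range n).biUnion fun i => univ.biUnion (F2 i)) : ℝ) ≤ n * (2 * (n * y) * T) := by
    calc (#((range n).biUnion fun i => univ.biUnion (F2 i)) : ℝ)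
        ≤ ((∑ i ∈ range n, ∑ U, #(F2 i U) : ℕ) : ℝ) := by
          exact_mod_cast card_biUnion_le.trans (sum_le_sum fun i _ => card_biUnion_le)
      _ ≤ ∑ i ∈ range n, ∑ U, 2 * (n * y) *
            (#{σ : InsertionSeq n | unvisitedSet (dfsRun R (insertedBefore σ t) i) = U} : ℝ) := by
          push_cast
          refine sum_le_sum fun i _ => sum_le_sum fun U _ => ?_
          simp only [hF2]
          split_ifs with h
          · exact hdisc i U h
          · simp only [card_empty, Nat.cast_zero]; positivity
      -- For fixed `i` the events that the unvisited set equals `U` partition the sequences, so the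
      -- sum over `U` costs no factor.
      _ = ∑ i ∈ range n, 2 * (n * y) * T := by
          refine sum_congr rfl fun i _ => ?_
          rw [← mul_sum]
          congr 1
          rw [hT, ← card_univ, card_eq_sum_card_fiberwise (t := univ)
            (f := fun σ : InsertionSeq n => unvisitedSet (dfsRun R (insertedBefore σ t) i))
            (by simp)]
          push_cast; rfl
      _ = _ := by simp
  calc _ ≤ (#(P.biUnion F1) : ℝ) + #((range n).biUnion fun i => univ.biUnion (F2 i)) := by
        exact_mod_cast (card_le_card hsub).trans (card_union_le _ _)
    _ ≤ 2 * (n * y) * T + n * (2 * (n * y) * T) := add_le_add hc1 hc2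
    _ = (2 * n + 2 * n ^ 2) * y * T := by ring
    _ ≤ 4 * n ^ 2 * y * T := by
        refine mul_le_mul_of_nonneg_right (mul_le_mul_of_nonneg_right ?_ (Real.exp_pos _).le)
          (by positivity)
        nlinarith
    _ = _ := by rw [hyn]; field_simp

open Classical in
/-- The probability that an insertion falls into the bristles. -/
theorem card_bristle_insertion_le (R : DFSRule n) (t : Fin (n.choose 2)) (r : ℕ) (hn : 2 ≤ n)
    (hr : 2 ≤ r) (hrn : r ≤ n) (hrt : 16 * Real.log n ≤ r * ((t : ℕ) / (8 * n.choose 2))) :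
    (#{σ : InsertionSeq n | ∀ a ∈ (σ t : Sym2 (Fin n)),
        some a ∈ bristles (dfsTree R (insertedBefore σ t)) none} : ℝ)
      ≤ (4 / (n : ℝ) ^ 2 + (r : ℝ) ^ 2 / (2 * (n.choose 2 - (t : ℕ)))) *
        Fintype.card (InsertionSeq n) := by
  -- The default `∅` keeps the size bound valid for every `σ`, also when the traversal has
  -- backtracked.
  set F : InsertionSeq n → Finset {e : Sym2 (Fin n) // ¬ e.IsDiag} := fun σ =>
    if #(unvisitedSet (dfsRun R (insertedBefore σ t) (n - r))) ≤ r then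
      innerEdges (unvisitedSet (dfsRun R (insertedBefore σ t) (n - r))) else ∅ with hF
  have hF_card : ∀ σ, (#(F σ) : ℝ) ≤ (r : ℝ) ^ 2 / 2 := by
    intro σ
    simp only [hF]
    split_ifs with h
    · rw [card_innerEdges]
      calc (((#(unvisitedSet (dfsRun R (insertedBefore σ t) (n - r)))).choose 2 : ℕ) : ℝ)
          ≤ ((r.choose 2 : ℕ) : ℝ) := by exact_mod_cast Nat.choose_le_choose 2 h
        _ ≤ _ := by
          rw [Nat.cast_choose_two]
          have : (0 : ℝ) ≤ r := by positivity
          nlinarith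
    · simp only [card_empty, Nat.cast_zero]; positivity
  have hmain := card_apply_mem_mul_le (univ.filter fun j : Fin (n.choose 2) => t ≤ j) F
    ((r : ℝ) ^ 2 / 2) hF_card
    (fun σ x hx y hy => by
      simp only [hF]
      rw [insertedBefore_swap_trans (by simpa using hx) (by simpa using hy)]) t (by simp)
  have hQ : (#(univ.filter fun j : Fin (n.choose 2) => t ≤ j) : ℝ) = n.choose 2 - (t : ℕ) := by
    have : (univ.filter fun j : Fin (n.choose 2) => t ≤ j) = Ici t := by ext; simp
    rw [this, Fin.card_Ici, Nat.cast_sub t.2.le]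
  have htN : (0 : ℝ) < n.choose 2 - (t : ℕ) := by
    rw [sub_pos]; exact_mod_cast t.2
  rw [hQ, ← le_div_iff₀ htN] at hmain
  have hbad := card_exists_not_cutConnected_le R t r hn t.2.le hr hrn hrt
  have hsub : ({σ : InsertionSeq n | ∀ a ∈ (σ t : Sym2 (Fin n)),
        some a ∈ bristles (dfsTree R (insertedBefore σ t)) none} : Finset (InsertionSeq n)) ⊆
      ({σ : InsertionSeq n | ∃ i ≤ n - r, ¬ CutConnected (insertedBefore σ t)
        (unvisitedSet (dfsRun R (insertedBefore σ t) i))} : Finset (InsertionSeq n)) ∪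
      ({σ : InsertionSeq n | σ t ∈ F σ} : Finset (InsertionSeq n)) := by
    intro σ hσ
    simp only [mem_union, mem_filter, mem_univ, true_and] at hσ ⊢
    by_cases hcon : ∃ i ≤ n - r, ¬ CutConnected (insertedBefore σ t)
        (unvisitedSet (dfsRun R (insertedBefore σ t) i))
    · exact Or.inl hcon
    · right
      push Not at hcon
      have hcard := card_unvisitedSet_dfsRun R (insertedBefore σ t) (n - r) (by omega)
        fun i hi => hcon i hi.le
      simp only [hF]
      rw [if_pos (by omega), mem_innerEdges]
      intro a ha
      rw [mem_unvisitedSet]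
      intro hv
      refine hσ a ha (onStick_of_cutConnected R _ ?_ (n - r) (by omega) hcon _ hv)
      intro b hb
      obtain ⟨i, -, hi⟩ := mem_insertedBefore.mp hb
      exact (σ i).2 (by rw [hi]; simp)
  calc _ ≤ (#{σ : InsertionSeq n | ∃ i ≤ n - r, ¬ CutConnected (insertedBefore σ t)
        (unvisitedSet (dfsRun R (insertedBefore σ t) i))} : ℝ) +
        #{σ : InsertionSeq n | σ t ∈ F σ} := by
        exact_mod_cast (card_le_card hsub).trans (card_union_le _ _)
    _ ≤ _ := add_le_add hbad hmain
    _ = _ := by rw [← div_div]; ring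

end RandomInsertions

/-! ### Summation over the insertion times. -/

section Expectation

open Classical in
/-- The expected number of insertions into the bristles, as a sum of probabilities. -/
theorem expectedOverInsertions_bristleInsertions {n : ℕ} (R : DFSRule n) :
    expectedOverInsertions n (fun σ => (bristleInsertions R σ : ℝ)) =
      ∑ t : Fin (n.choose 2), (#{σ : InsertionSeq n | ∀ a ∈ (σ t : Sym2 (Fin n)),
        some a ∈ bristles (dfsTree R (insertedBefore σ t)) none} : ℝ) /
          Fintype.card (InsertionSeq n) := by
  unfold expectedOverInsertions
  rw [← sum_div]
  congr 1
  have h : ∀ σ : InsertionSeq n, bristleInsertions R σ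
      = #{t : Fin (n.choose 2) | ∀ a ∈ (σ t : Sym2 (Fin n)),
        some a ∈ bristles (dfsTree R (insertedBefore σ t)) none} := by
    intro σ
    unfold bristleInsertions
    rw [← Set.ncard_coe_finset]
    congr 1
    ext t; simp
  simp only [h, card_filter]
  push_cast
  exact sum_comm

theorem sum_inv_sq_le (N : ℕ) (k : ℕ) (hk : k ≠ 0) :
    ∑ t ∈ range N with k < t, ((t : ℝ) ^ 2)⁻¹ ≤ (k : ℝ)⁻¹ := by
  rcases le_or_gt k N with h | h
  · have h1 := sum_Ioc_inv_sq_le_sub (α := ℝ) hk h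
    have h2 : ∑ t ∈ range N with k < t, ((t : ℝ) ^ 2)⁻¹ ≤ ∑ t ∈ Ioc k N, ((t : ℝ) ^ 2)⁻¹ := by
      refine sum_le_sum_of_subset_of_nonneg ?_ fun i _ _ => by positivity
      intro t ht
      simp only [mem_filter, mem_range, mem_Ioc] at ht ⊢
      omega
    have h3 : (0 : ℝ) ≤ (N : ℝ)⁻¹ := by positivity
    linarith
  · rw [sum_eq_zero]
    · positivity
    · intro t ht
      simp only [mem_filter, mem_range] at ht
      omega

/-- The pointwise estimate with the best choice of the size of the bristles. -/
theorem exists_size_bound {n t : ℕ} (hn : 2 ≤ n)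
    (h1 : 128 * (n * Real.log n) < t) (h2 : n * Real.log n < (n.choose 2 : ℝ) - t) :
    ∃ r : ℕ, 2 ≤ r ∧ r ≤ n ∧ 16 * Real.log n ≤ r * (t / (8 * n.choose 2)) ∧
      (r : ℝ) ^ 2 / (2 * (n.choose 2 - t)) ≤
        32768 * Real.log n ^ 2 * (n.choose 2 : ℝ) * ((t : ℝ) ^ 2)⁻¹ + 65536 * Real.log n / n := by
  have hn2 : (2 : ℝ) ≤ n := by exact_mod_cast hn
  have hn0 : (0 : ℝ) < n := by linarith
  have hℓ : 1 / 2 < Real.log n := by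
    have := Real.log_two_gt_d9
    have := Real.log_le_log (by norm_num) hn2
    linarith
  set ℓ := Real.log n with hℓd
  have hNc : ((n.choose 2 : ℕ) : ℝ) = n * (n - 1) / 2 := Nat.cast_choose_two ℝ n
  set N : ℝ := ((n.choose 2 : ℕ) : ℝ) with hN
  have hnℓ : 0 < n * ℓ := by positivity
  have ht0 : (0 : ℝ) < t := by linarith
  have hd0 : 0 < N - t := by linarith
  have hN0 : 0 < N := by linarith
  -- The solution of `16 * ℓ = a * (t / (8 * N))`. It is at least `64`, so rounding up at most
  -- doubles it; it is at most `n` because `t > 128 * n * ℓ`.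
  set a : ℝ := 128 * ℓ * N / t with ha
  have ha64 : 64 ≤ a := by
    rw [ha, le_div_iff₀ ht0]; nlinarith
  have hceil := Nat.ceil_lt_add_one (a := a) (by linarith)
  have hle := Nat.le_ceil a
  have hr : (⌈a⌉₊ : ℝ) ≤ 2 * a := by linarith
  refine ⟨⌈a⌉₊, ?_, ?_, ?_, ?_⟩
  · have : (2 : ℝ) ≤ ⌈a⌉₊ := by linarith
    exact_mod_cast this
  · rw [Nat.ceil_le, ha, div_le_iff₀ ht0, hNc]
    have : (n : ℝ) * (128 * (n * ℓ)) ≤ n * t := mul_le_mul_of_nonneg_left h1.le hn0.le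
    nlinarith
  · have : 16 * ℓ = a * (t / (8 * N)) := by rw [ha]; field_simp; norm_num
    rw [this]
    exact mul_le_mul_of_nonneg_right hle (by positivity)
  · calc (⌈a⌉₊ : ℝ) ^ 2 / (2 * (N - t)) ≤ (2 * a) ^ 2 / (2 * (N - t)) := by gcongr
      -- Partial fractions: `N² / (t² (N - t)) = N / t² + 1 / t + 1 / (N - t)`.
      _ = 32768 * ℓ ^ 2 * (N * ((t : ℝ) ^ 2)⁻¹ + 1 / t + 1 / (N - t)) := by
        rw [ha]; field_simp; ring
      _ ≤ 32768 * ℓ ^ 2 * (N * ((t : ℝ) ^ 2)⁻¹ + 1 / (n * ℓ) + 1 / (n * ℓ)) := by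
        have : n * ℓ ≤ t := by linarith
        gcongr
      _ = _ := by field_simp; ring

theorem card_filter_near_end_le (N k : ℕ) :
    #{t ∈ range N | N ≤ t + k} ≤ k := by
  calc _ ≤ #(Ico (N - k) N) := card_le_card fun t ht => by
        simp only [mem_filter, mem_range, mem_Ico] at ht ⊢; omega
    _ ≤ k := by rw [Nat.card_Ico]; omega

end Expectation

theorem mainTheorem3 :
    ∃ C : ℝ, ∀ (n : ℕ) (R : DFSRule n),
      expectedOverInsertions n (fun σ => (bristleInsertions R σ : ℝ))
        ≤ C * ((n : ℝ) * Real.log (n : ℝ)) := by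
  classical
  -- The contributions add up to at most `(128 + 1 + 32768 + 16384) * (n * ℓ) + 3`, and `n * ℓ ≥ 1`;
  -- the constant is generous.
  refine ⟨100000, fun n R => ?_⟩
  rw [expectedOverInsertions_bristleInsertions]
  rcases lt_or_ge n 2 with hn | hn
  · have : IsEmpty (Fin (n.choose 2)) := by
      rw [Nat.choose_eq_zero_of_lt hn]; infer_instance
    rw [univ_eq_empty, sum_empty]
    have := Real.log_natCast_nonneg n
    positivity
  have hn2 : (2 : ℝ) ≤ n := by exact_mod_cast hn
  have hn0 : (0 : ℝ) < n := by linarith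
  have hℓ : 1 / 2 < Real.log n := by
    have := Real.log_two_gt_d9
    have := Real.log_le_log (by norm_num) hn2
    linarith
  have hcard : (0 : ℝ) < Fintype.card (InsertionSeq n) := by
    have := insertionSeq_nonempty n
    exact_mod_cast Fintype.card_pos
  set ℓ := Real.log n with hℓd
  set N := n.choose 2 with hN
  have hNc : (N : ℝ) = n * (n - 1) / 2 := Nat.cast_choose_two ℝ n
  have hnℓ : 1 ≤ n * ℓ := by nlinarith
  set k := ⌊128 * (n * ℓ)⌋₊ with hk
  set k' := ⌊n * ℓ⌋₊ with hk'
  have hkle : (k : ℝ) ≤ 128 * (n * ℓ) := Nat.floor_le (by positivity)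
  have hk'le : (k' : ℝ) ≤ n * ℓ := Nat.floor_le (by positivity)
  have hkge : n * ℓ ≤ k := by
    have := Nat.lt_floor_add_one (128 * (n * ℓ))
    rw [← hk] at this
    linarith
  have hk0 : k ≠ 0 := by
    rintro h; rw [h, Nat.cast_zero] at hkge; linarith
  set c : ℝ := 4 / (n : ℝ) ^ 2 + 65536 * ℓ / n with hc
  have hc0 : 0 ≤ c := by positivity
  -- The two indicators pay the trivial bound one for early and late times. The other terms come
  -- from `card_bristle_insertion_le` with the size from `exists_size_bound`.
  set b : ℕ → ℝ := fun t => (if t ≤ k then 1 else 0) + (if N ≤ t + k' then 1 else 0) + c +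
    32768 * ℓ ^ 2 * N * (if k < t then ((t : ℝ) ^ 2)⁻¹ else 0) with hb
  have hpt : ∀ t : Fin N, (#{σ : InsertionSeq n | ∀ a ∈ (σ t : Sym2 (Fin n)),
        some a ∈ bristles (dfsTree R (insertedBefore σ t)) none} : ℝ) /
          Fintype.card (InsertionSeq n) ≤ b t := by
    intro t
    have hone : (#{σ : InsertionSeq n | ∀ a ∈ (σ t : Sym2 (Fin n)),
        some a ∈ bristles (dfsTree R (insertedBefore σ t)) none} : ℝ) /
          Fintype.card (InsertionSeq n) ≤ 1 := by
      rw [div_le_one hcard]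
      exact_mod_cast card_le_univ _
    have hsq : (0 : ℝ) ≤ 32768 * ℓ ^ 2 * N * (if k < (t : ℕ) then (((t : ℕ) : ℝ) ^ 2)⁻¹ else 0) := by
      split_ifs <;> positivity
    by_cases h1 : (t : ℕ) ≤ k
    · simp only [hb, if_pos h1] at hsq ⊢
      have : (0 : ℝ) ≤ if N ≤ (t : ℕ) + k' then 1 else 0 := by split_ifs <;> norm_num
      linarith
    by_cases h2 : N ≤ (t : ℕ) + k'
    · simp only [hb, if_pos h2, if_neg h1] at hsq ⊢
      linarith
    have h1' : 128 * (n * ℓ) < ((t : ℕ) : ℝ) := Nat.lt_of_floor_lt (not_le.mp h1)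
    have h2' : n * ℓ < (N : ℝ) - (t : ℕ) := by
      have h3 : k' < N - t := by omega
      have := Nat.lt_of_floor_lt h3
      rwa [Nat.cast_sub t.2.le] at this
    obtain ⟨r, hr2, hrn, hrt, hrb⟩ := exists_size_bound hn h1' h2'
    rw [div_le_iff₀ hcard]
    refine (card_bristle_insertion_le R t r hn hr2 hrn hrt).trans ?_
    refine mul_le_mul_of_nonneg_right ?_ hcard.le
    simp only [hb, if_neg h1, if_neg h2, if_pos (not_le.mp h1), hc]
    linarith
  refine (sum_le_sum fun t _ => hpt t).trans ?_
  rw [Fin.sum_univ_eq_sum_range b N]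
  simp only [hb, sum_add_distrib, ← mul_sum, ← sum_filter, sum_const, card_range, nsmul_eq_mul,
    mul_one]
  have s1 : (#{t ∈ range N | t ≤ k} : ℝ) ≤ k + 1 := by
    have : #{t ∈ range N | t ≤ k} ≤ k + 1 := by
      calc _ ≤ #(range (k + 1)) := card_le_card fun t ht => by
            simp only [mem_filter, mem_range] at ht ⊢; omega
        _ = k + 1 := card_range _
    exact_mod_cast this
  have s2 : (#{t ∈ range N | N ≤ t + k'} : ℝ) ≤ k' := by
    exact_mod_cast card_filter_near_end_le N k'
  have hNn : (N : ℝ) ≤ n ^ 2 / 2 := by rw [hNc]; nlinarith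
  have s3 : (N : ℝ) * c ≤ 2 + 32768 * (n * ℓ) := by
    calc (N : ℝ) * c ≤ n ^ 2 / 2 * c := mul_le_mul_of_nonneg_right hNn hc0
      _ = 2 + 32768 * (n * ℓ) := by rw [hc]; field_simp; ring
  have s4 : 32768 * ℓ ^ 2 * N * ∑ t ∈ range N with k < t, ((t : ℝ) ^ 2)⁻¹ ≤ 16384 * (n * ℓ) := by
    calc _ ≤ 32768 * ℓ ^ 2 * (n ^ 2 / 2) * (n * ℓ)⁻¹ := by
          refine mul_le_mul (by gcongr) ?_ (sum_nonneg fun t _ => by positivity) (by positivity)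
          exact (sum_inv_sq_le N k hk0).trans (inv_anti₀ (by positivity) hkge)
      _ = _ := by field_simp; norm_num
  linarith
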